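/- Let $d, n \in \mathbb{N}$ with $n \ge 2$, let $0 < \alpha < \beta \le 1$, and let $I = [0,1]$. For $\gamma \in (0,1]$ let $C^{n,\gamma}_0(\mathbb{R}^d,\mathbb{R}^d)$ be the Banach space of all $f \in C^n(\mathbb{R}^d,\mathbb{R}^d)$ such that $f^{(l)}(x) \to 0$ as $\|x\| \to \infty$ for all $0 \le l \le n$ and $$\|f\|_{n,\gamma} := \max\Big\{ \sup_{x \in \mathbb{R}^d,\ 0 \le l \le n} \|f^{(l)}(x)\|,\ \sup_{x \ne y} \frac{\|f^{(n)}(x) - f^{(n)}(y)\|}{\|x-y\|^{\gamma}} \Big\} < \infty,$$ where $f^{(l)}$ is the Fréchet derivative of order $l$, measured in the operator norm of $l$-linear mappings. Let $$\mathcal{D}^{n,\gamma}(\mathbb{R}^d) := \{ \Phi \in \mathrm{Id} + C^{n,\gamma}_0(\mathbb{R}^d,\mathbb{R}^d) : \det d\Phi(x) > 0 \text{ for all } x \in \mathbb{R}^d \},$$ with the metric $d(\Phi,\Psi) = \|\Phi - \Psi\|_{n,\gamma}$, and let $C(I,\mathcal{D}^{n,\gamma}(\mathbb{R}^d))$ be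 the space of continuous mappings $I \to \mathcal{D}^{n,\gamma}(\mathbb{R}^d)$ with the supremum metric. Let $L^1(I,C^{n,\beta}_0(\mathbb{R}^d,\mathbb{R}^d))$ be the space of classes, with respect to almost everywhere equality, of Bochner integrable functions $u : I \to C^{n,\beta}_0(\mathbb{R}^d,\mathbb{R}^d)$, with the norm $\int_0^1 \|u(t)\|_{n,\beta}\,dt$. A pointwise flow of such a $u$ is a mapping $\Phi : I \times \mathbb{R}^d \to \mathbb{R}^d$ such that, for every $x \in \mathbb{R}^d$, the function $s \mapsto u(s)(\Phi(s,x))$ is integrable on $I$ and $$\Phi(t,x) = x + \int_0^t u(s)(\Phi(s,x))\,ds \quad \text{for all } t \in I.$$ Theorem. Every $u \in L^1(I,C^{n,\beta}_0(\mathbb{R}^d,\mathbb{R}^d))$ has a unique pointwise flow $\Phi_u$, and $t \mapsto \Phi_u(t,\cdot)$ belongs to $C(I,\mathcal{D}^{n,\alpha}(\mathbb{R}^d))$. The resulting flow map $$L^1(I,C^{n,\beta}_0(\mathbb{R}^d,\mathbb{R}^d)) \to C(I,\mathcal{D}^{n,\alpha}(\mathbb{R}^d)), \quad u \mapsto \Phi_u,$$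 is continuous. It is even locally Hölder of order $\beta - \alpha$: every $u_0$ has a neighbourhood $V$ for which there is a constant $C \ge 0$ such that $$\sup_{t \in I} \|\Phi_u(t,\cdot) - \Phi_v(t,\cdot)\|_{n,\alpha} \le C \Big( \int_0^1 \|u(t) - v(t)\|_{n,\beta}\,dt \Big)^{\beta-\alpha} \quad \text{for all } u, v \in V.$$ -/

import Mathlib

open MeasureTheory Set Filter Topology
open scoped NNReal ENNReal

noncomputable section

namespace HolderFlow

section HolderSpace

variable {E F : Type*} [NormedAddCommGroup E] [NormedSpace ℝ E]
  [NormedAddCommGroup F] [NormedSpace ℝ F]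

/-- The `C^k`-norm `‖f‖_k = sup {‖f^{(l)}(x)‖ : x ∈ E, 0 ≤ l ≤ k}`, with values in `[0, ∞]`. -/
def eCkNorm (k : ℕ) (f : E → F) : ℝ≥0∞ :=
  ⨆ (l : ℕ) (_ : l ≤ k) (x : E), ‖iteratedFDeriv ℝ l f x‖ₑ

/-- The Hölder norm `‖f‖_{k,α} = max {‖f‖_k, [f]_{k,α}}`, with values in `[0, ∞]`, where
`[f]_{k,α}` is the `α`-Hölder constant of the `k`-th Fréchet derivative `f^{(k)}`. -/
def eCkHolderNorm (k : ℕ) (α : ℝ≥0) (f : E → F) : ℝ≥0∞ :=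
  max (eCkNorm k f) (eHolderNorm α (iteratedFDeriv ℝ k f))

theorem enorm_iteratedFDeriv_le {k l : ℕ} (hl : l ≤ k) (α : ℝ≥0) (f : E → F) (x : E) :
    ‖iteratedFDeriv ℝ l f x‖ₑ ≤ eCkHolderNorm k α f :=
  ((le_iSup (fun x => ‖iteratedFDeriv ℝ l f x‖ₑ) x).trans
    (le_iSup₂ (f := fun (l : ℕ) (_ : l ≤ k) => ⨆ x : E, ‖iteratedFDeriv ℝ l f x‖ₑ) l hl)).trans
    (le_max_left _ _)

theorem eCkHolderNorm_add_le {k : ℕ} {α : ℝ≥0} {f g : E → F}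
    (hf : ContDiff ℝ k f) (hg : ContDiff ℝ k g) :
    eCkHolderNorm k α (f + g) ≤ eCkHolderNorm k α f + eCkHolderNorm k α g := by
  refine max_le ?_ ?_
  · refine iSup_le fun l => iSup_le fun hl => iSup_le fun x => ?_
    have hl' : (l : WithTop ℕ∞) ≤ k := by exact_mod_cast hl
    rw [iteratedFDeriv_add (hf.of_le hl') (hg.of_le hl'), Pi.add_apply]
    refine (enorm_add_le (iteratedFDeriv ℝ l f x) (iteratedFDeriv ℝ l g x)).trans 
      (add_le_add (enorm_iteratedFDeriv_le hl α f x) (enorm_iteratedFDeriv_le hl α g x))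
  · rw [iteratedFDeriv_add hf hg]
    exact eHolderNorm_add_le.trans (add_le_add (le_max_right _ _) (le_max_right _ _))

theorem iteratedFDeriv_smul_of_le {k l : ℕ} (hl : l ≤ k) (c : ℝ) {f : E → F}
    (hf : ContDiff ℝ k f) : iteratedFDeriv ℝ l (c • f) = c • iteratedFDeriv ℝ l f := by
  have hl' : (l : WithTop ℕ∞) ≤ k := by exact_mod_cast hl
  funext x
  exact iteratedFDeriv_const_smul_apply (hf.of_le hl').contDiffAt

theorem eHolderNorm_real_smul {X Y : Type*} [NormedAddCommGroup X] [NormedAddCommGroup Y]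
    [NormedSpace ℝ Y] (α : ℝ≥0) (c : ℝ) (g : X → Y) :
    eHolderNorm α (c • g) = ‖c‖ₑ * eHolderNorm α g := eHolderNorm_smul c

theorem eCkHolderNorm_smul_le {k : ℕ} {α : ℝ≥0} (c : ℝ) {f : E → F} (hf : ContDiff ℝ k f) :
    eCkHolderNorm k α (c • f) ≤ ‖c‖ₑ * eCkHolderNorm k α f := by
  refine max_le ?_ ?_
  · refine iSup_le fun l => iSup_le fun hl => iSup_le fun x => ?_
    rw [iteratedFDeriv_smul_of_le hl c hf, Pi.smul_apply, enorm_smul]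
    exact mul_le_mul_right (enorm_iteratedFDeriv_le hl α f x) _
  · rw [iteratedFDeriv_smul_of_le le_rfl c hf]
    refine (eHolderNorm_real_smul α c (iteratedFDeriv ℝ k f)).le.trans ?_
    exact mul_le_mul_right (le_max_right _ _) _

theorem eCkHolderNorm_smul {k : ℕ} {α : ℝ≥0} (c : ℝ) {f : E → F} (hf : ContDiff ℝ k f) :
    eCkHolderNorm k α (c • f) = ‖c‖ₑ * eCkHolderNorm k α f := by
  refine le_antisymm (eCkHolderNorm_smul_le c hf) ?_
  by_cases hc : c = 0
  · simp [hc]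
  have h := eCkHolderNorm_smul_le (α := α) c⁻¹ (hf.const_smul c)
  rw [show c⁻¹ • (fun x => c • f x) = f from by funext x; simp [smul_smul, hc]] at h
  have h1 : ‖c‖ₑ * ‖c⁻¹‖ₑ = 1 := by
    rw [← enorm_mul, mul_inv_cancel₀ hc, enorm_one]
  calc ‖c‖ₑ * eCkHolderNorm k α f ≤ ‖c‖ₑ * (‖c⁻¹‖ₑ * eCkHolderNorm k α (c • f)) :=
        mul_le_mul_right h _
    _ = eCkHolderNorm k α (c • f) := by rw [← mul_assoc, h1, one_mul]

theorem eCkHolderNorm_zero (k : ℕ) (α : ℝ≥0) : eCkHolderNorm k α (0 : E → F) = 0 := by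
  have h := eCkHolderNorm_smul (E := E) (F := F) (k := k) (α := α) (0 : ℝ) (f := 0) contDiff_const
  simpa using h

theorem enorm_apply_le_eCkHolderNorm (k : ℕ) (α : ℝ≥0) (f : E → F) (x : E) :
    ‖f x‖ₑ ≤ eCkHolderNorm k α f := by
  refine le_trans ?_ (enorm_iteratedFDeriv_le (Nat.zero_le k) α f x)
  rw [← ofReal_norm, ← ofReal_norm, norm_iteratedFDeriv_zero]

variable (E F) in
/-- The vector space of all `f ∈ C^k(E, F)` with `‖f‖_{k,α} < ∞` such that `f^{(l)}(x) → 0` as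
`‖x‖ → ∞`, for all `0 ≤ l ≤ k`. -/
def holderZeroSubmodule (k : ℕ) (α : ℝ≥0) : Submodule ℝ (E → F) where
  carrier := {f | ContDiff ℝ k f ∧ eCkHolderNorm k α f < ∞ ∧
    ∀ l ≤ k, Tendsto (iteratedFDeriv ℝ l f) (Bornology.cobounded E) (𝓝 0)}
  add_mem' := by
    rintro f g ⟨hf, hf', hf''⟩ ⟨hg, hg', hg''⟩
    refine ⟨hf.add hg, (eCkHolderNorm_add_le hf hg).trans_lt (ENNReal.add_lt_top.2 ⟨hf', hg'⟩), ?_⟩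
    intro l hl
    have hl' : (l : WithTop ℕ∞) ≤ k := by exact_mod_cast hl
    rw [iteratedFDeriv_add (hf.of_le hl') (hg.of_le hl')]
    have h0 := (hf'' l hl).add (hg'' l hl)
    rw [add_zero] at h0
    exact h0
  zero_mem' := by
    refine ⟨contDiff_const, by rw [eCkHolderNorm_zero]; exact ENNReal.zero_lt_top, ?_⟩
    intro l _
    have h : iteratedFDeriv ℝ l (0 : E → F) = 0 := iteratedFDeriv_fun_zero
    rw [h]
    exact tendsto_const_nhds
  smul_mem' := by
    rintro c f ⟨hf, hf', hf''⟩
    refine ⟨hf.const_smul c, ?_, ?_⟩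
    · rw [eCkHolderNorm_smul c hf]
      exact ENNReal.mul_lt_top enorm_lt_top hf'
    · intro l hl
      rw [iteratedFDeriv_smul_of_le hl c hf]
      have h0 := (hf'' l hl).const_smul c
      rw [smul_zero] at h0
      exact h0

variable (E F) in
/-- The Hölder space `C^{k,α}_0(E, F)`. It is a type of its own, so that it carries the topology
of the Hölder norm and not that of pointwise convergence. -/
def HolderZero (k : ℕ) (α : ℝ≥0) : Type _ := ↥(holderZeroSubmodule E F k α)

namespace HolderZero

variable {k : ℕ} {α : ℝ≥0}

instance : AddCommGroup (HolderZero E F k α) :=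
  inferInstanceAs (AddCommGroup ↥(holderZeroSubmodule E F k α))

instance : Module ℝ (HolderZero E F k α) :=
  inferInstanceAs (Module ℝ ↥(holderZeroSubmodule E F k α))

instance : CoeFun (HolderZero E F k α) (fun _ => E → F) := ⟨fun f => f.1⟩

instance : Norm (HolderZero E F k α) := ⟨fun f => (eCkHolderNorm k α (f : E → F)).toReal⟩

theorem norm_def (f : HolderZero E F k α) : ‖f‖ = (eCkHolderNorm k α (f : E → F)).toReal := rfl

theorem core : NormedSpace.Core ℝ (HolderZero E F k α) where
  norm_nonneg f := ENNReal.toReal_nonneg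
  norm_smul c f := by
    rw [norm_def, norm_def]
    have h : eCkHolderNorm k α ((c • f : HolderZero E F k α) : E → F)
        = ‖c‖ₑ * eCkHolderNorm k α (f : E → F) := eCkHolderNorm_smul c f.2.1
    rw [h, ENNReal.toReal_mul, toReal_enorm]
  norm_triangle f g := by
    rw [norm_def, norm_def, norm_def, ← ENNReal.toReal_add f.2.2.1.ne g.2.2.1.ne]
    exact ENNReal.toReal_mono (ENNReal.add_lt_top.2 ⟨f.2.2.1, g.2.2.1⟩).ne
      (eCkHolderNorm_add_le f.2.1 g.2.1)
  norm_eq_zero_iff f := by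
    constructor
    · intro h
      rw [norm_def, ENNReal.toReal_eq_zero_iff, or_iff_left f.2.2.1.ne] at h
      refine Subtype.ext (funext fun x => ?_)
      have hx := enorm_apply_le_eCkHolderNorm k α (f : E → F) x
      rw [h, nonpos_iff_eq_zero, enorm_eq_zero] at hx
      exact hx
    · rintro rfl
      have h : eCkHolderNorm k α ((0 : HolderZero E F k α) : E → F) = 0 := eCkHolderNorm_zero k α
      rw [norm_def, h, ENNReal.toReal_zero]

instance : NormedAddCommGroup (HolderZero E F k α) := NormedAddCommGroup.ofCore core

instance : NormedSpace ℝ (HolderZero E F k α) := NormedSpace.ofCore core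

end HolderZero

end HolderSpace

/-- The set `𝒟^{n,α}(ℝ^d)` of all `Φ ∈ Id + C^{n,α}_0(ℝ^d, ℝ^d)` with `det dΦ(x) > 0` for all `x`.
An element is recorded by its displacement `Φ - Id`. -/
@[ext] structure HolderDiffeo (d n : ℕ) (α : ℝ≥0) where
  disp : HolderZero (EuclideanSpace ℝ (Fin d)) (EuclideanSpace ℝ (Fin d)) n α
  det_pos : ∀ x, 0 < (fderiv ℝ (fun y => y + disp y) x).det

namespace HolderDiffeo

variable {d n : ℕ} {α : ℝ≥0}

/-- The mapping `Φ = Id + disp : ℝ^d → ℝ^d`. -/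
def toFun (Φ : HolderDiffeo d n α) (x : EuclideanSpace ℝ (Fin d)) : EuclideanSpace ℝ (Fin d) :=
  x + Φ.disp x

/-- The metric `dist Φ Ψ = ‖Φ - Ψ‖_{n,α}`. -/
instance : MetricSpace (HolderDiffeo d n α) :=
  MetricSpace.induced disp (fun _ _ h => HolderDiffeo.ext h) inferInstance

end HolderDiffeo

/-- The Banach space `L^1([0,1], C^{n,β}_0(ℝ^d, ℝ^d))` of (classes of) Bochner integrable
functions. -/
abbrev TimeDepField (d n : ℕ) (β : ℝ≥0) : Type :=
  Lp (HolderZero (EuclideanSpace ℝ (Fin d)) (EuclideanSpace ℝ (Fin d)) n β) 1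
    (volume.restrict (Icc (0 : ℝ) 1))

/-- `Φ : [0,1] × ℝ^d → ℝ^d` is a pointwise flow of `u`: for all `x`, the function
`s ↦ u(s)(Φ(s,x))` is integrable on `[0,1]`, and `Φ(t,x) = x + ∫_0^t u(s)(Φ(s,x)) ds` for all
`t ∈ [0,1]`. (On `[0,1]` the projection `projIcc` is the identity.) -/
def IsPointwiseFlow {d n : ℕ} {β : ℝ≥0} (u : TimeDepField d n β)
    (Φ : Icc (0 : ℝ) 1 → EuclideanSpace ℝ (Fin d) → EuclideanSpace ℝ (Fin d)) : Prop :=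
  ∀ x : EuclideanSpace ℝ (Fin d),
    IntegrableOn (fun s : ℝ => u s (Φ (projIcc 0 1 zero_le_one s) x)) (Icc (0 : ℝ) 1) ∧
    ∀ t : Icc (0 : ℝ) 1,
      Φ t x = x + ∫ s in (0 : ℝ)..t, u s (Φ (projIcc 0 1 zero_le_one s) x)

end HolderFlow

end

open HolderFlow

/-! Write the flow as `id + φ`. Since almost every `u s` is Lipschitz with constant of order `‖u
s‖`, integrable in `s`, Picard iteration and Gronwall's inequality with an integrable kernel give
existence and uniqueness for each starting point. The space derivative of `φ` solves the variational
equation `∂ₜ g = (Du ∘ Φ) g + Du ∘ Φ`, which is linear. Solutions of linear equations are as regular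
in the parameter as the coefficients (`SolvesLinear.ckBound`), so a `C^k` bound on `φ` gives one on
`Du ∘ Φ`, hence on `g`, hence a `C^{k+1}` bound on `φ`. This bootstrap ends at `C^{n,β}`
(`IsFlowDisp.ckBound`).

For two fields `u`, `v` with `D` of the order of their distance, the difference of the variational
equations contains `Dv ∘ Φ - Dv ∘ Ψ`. The top derivative of `v` is only `β`-Hölder, so this term is
of order `D ^ β`, and only in the sup norms of derivatives. The same bootstrap gives a `C^n`
distance of the flows of order `D ^ β` (`IsFlowDisp.ckBound_sub`). Their `C^{n,β}` distance is
merely bounded. Interpolating between the two bounds (`CkBound.interpolate`) gives `(D ^ β) ^ (1 - α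
/ β) = D ^ (β - α)` in `C^{n,α}`, and continuity follows.

All estimates are made with `CkBound`, which is defined by recursion through `fderiv` and so suits
induction on the order. Exponent `0` is allowed: there the Hölder condition only bounds the
oscillation, so one predicate serves both the Hölder norms and the plain `C^k` norms. -/

namespace HolderFlow

set_option linter.unusedSectionVars false

/-! ### Calculus of Hölder bounds: products, composition, interpolation. -/

section Bounds

variable {E F G H : Type} [NormedAddCommGroup E] [NormedSpace ℝ E]
  [NormedAddCommGroup F] [NormedSpace ℝ F] [NormedAddCommGroup G] [NormedSpace ℝ G]
  [NormedAddCommGroup H] [NormedSpace ℝ H]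

/-- `f` is bounded by `C`, is `γ`-Hölder with constant `C`, and vanishes at infinity. -/
structure HolderBound (γ C : ℝ) (f : E → F) : Prop where
  bound : ∀ x, ‖f x‖ ≤ C
  holder : ∀ x y, ‖f x - f y‖ ≤ C * ‖x - y‖ ^ γ
  decay : Tendsto f (Bornology.cobounded E) (𝓝 0)

/-- `f` is `k` times differentiable and all its derivatives up to the order `k` satisfy
`HolderBound γ C`. -/
def CkBound : (k : ℕ) → {F : Type} → [NormedAddCommGroup F] → [NormedSpace ℝ F] →
    (γ C : ℝ) → (E → F) → Prop
  | 0, _, _, _, γ, C, f => HolderBound γ C f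
  | k + 1, _, _, _, γ, C, f =>
    HolderBound γ C f ∧ Differentiable ℝ f ∧ CkBound k γ C (fderiv ℝ f)

variable {k : ℕ} {γ C C₁ C₂ : ℝ} {f : E → F} {g : E → G}

theorem HolderBound.nonneg (h : HolderBound γ C f) : 0 ≤ C :=
  (norm_nonneg _).trans (h.bound 0)

theorem HolderBound.mono (h : HolderBound γ C₁ f) (hC : C₁ ≤ C₂) : HolderBound γ C₂ f where
  bound x := (h.bound x).trans hC
  holder x y := (h.holder x y).trans (by gcongr)
  decay := h.decay

/-- At distance at most `1` powers decrease in the exponent; at larger distance the sup bound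
suffices, at the price of the factor `2`. -/
theorem HolderBound.mono_exponent {γ' : ℝ} (h : HolderBound γ C f) (h0 : 0 ≤ γ') (hγ : γ' ≤ γ) :
    HolderBound γ' (2 * C) f where
  bound x := (h.bound x).trans (by linarith [h.nonneg])
  holder x y := by
    have hC := h.nonneg
    rcases le_total ‖x - y‖ 1 with h1 | h1
    · have h2 : ‖x - y‖ ^ γ ≤ ‖x - y‖ ^ γ' := by
        rcases eq_or_lt_of_le (norm_nonneg (x - y)) with h3 | h3
        · rw [← h3]
          -- Real powers have `0 ^ 0 = 1`, so coinciding points need a separate look when the new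
          -- exponent is `0`.
          rcases eq_or_lt_of_le h0 with h4 | h4
          · rw [← h4, Real.rpow_zero]
            exact Real.zero_rpow_le_one γ
          · rw [Real.zero_rpow h4.ne', Real.zero_rpow (h4.trans_le hγ).ne']
        · exact Real.rpow_le_rpow_of_exponent_ge h3 h1 hγ
      calc _ ≤ C * ‖x - y‖ ^ γ := h.holder x y
        _ ≤ C * ‖x - y‖ ^ γ' := by gcongr
        _ ≤ _ := by
          have : 0 ≤ C * ‖x - y‖ ^ γ' := by positivity
          linarith
    · calc _ ≤ ‖f x‖ + ‖f y‖ := norm_sub_le _ _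
        _ ≤ 2 * C * 1 := by linarith [h.bound x, h.bound y]
        _ ≤ _ := by
          gcongr
          exact Real.one_le_rpow h1 h0
  decay := h.decay

theorem HolderBound.add {g : E → F} (hf : HolderBound γ C₁ f) (hg : HolderBound γ C₂ g) :
    HolderBound γ (C₁ + C₂) (fun x => f x + g x) where
  bound x := (norm_add_le _ _).trans (add_le_add (hf.bound x) (hg.bound x))
  holder x y := by
    rw [add_sub_add_comm, add_mul]
    exact (norm_add_le _ _).trans (add_le_add (hf.holder x y) (hg.holder x y))
  decay := by simpa using hf.decay.add hg.decay

theorem HolderBound.clm_comp (hf : HolderBound γ C f) (L : F →L[ℝ] G) (hL : ‖L‖ ≤ 1) :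
    HolderBound γ C (fun x => L (f x)) where
  bound x := (L.le_of_opNorm_le hL _).trans (by simpa using hf.bound x)
  holder x y := by
    rw [← map_sub]
    exact (L.le_of_opNorm_le hL _).trans (by simpa using hf.holder x y)
  decay := by
    have := (L.continuous.tendsto 0).comp hf.decay
    rwa [map_zero] at this

theorem HolderBound.bilinear (hf : HolderBound γ C₁ f) (hg : HolderBound γ C₂ g)
    (L : F →L[ℝ] G →L[ℝ] H) (hL : ‖L‖ ≤ 1) :
    HolderBound γ (2 * (C₁ * C₂)) (fun x => L (f x) (g x)) := by
  have h1 := hf.nonneg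
  have h2 := hg.nonneg
  have key : ∀ v w, ‖L v w‖ ≤ ‖v‖ * ‖w‖ := fun v w => by
    refine (L.le_opNorm₂ v w).trans ?_
    have := mul_le_mul_of_nonneg_right hL (mul_nonneg (norm_nonneg v) (norm_nonneg w))
    linarith
  have hb : ∀ x, ‖L (f x) (g x)‖ ≤ C₁ * C₂ := fun x =>
    (key _ _).trans (mul_le_mul (hf.bound x) (hg.bound x) (norm_nonneg _) h1)
  refine ⟨fun x => (hb x).trans (by nlinarith [mul_nonneg h1 h2]), fun x y => ?_, ?_⟩
  · have : L (f x) (g x) - L (f y) (g y) = L (f x) (g x - g y) + L (f x - f y) (g y) := by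
      simp
    rw [this]
    calc _ ≤ ‖f x‖ * ‖g x - g y‖ + ‖f x - f y‖ * ‖g y‖ :=
          (norm_add_le _ _).trans (add_le_add (key _ _) (key _ _))
      _ ≤ C₁ * (C₂ * ‖x - y‖ ^ γ) + C₁ * ‖x - y‖ ^ γ * C₂ := by
          have := hf.bound x
          have := hg.bound y
          have := hf.holder x y
          have := hg.holder x y
          gcongr
      _ = _ := by ring
  · refine squeeze_zero_norm (a := fun x => ‖f x‖ * C₂) (fun x => (key _ _).trans ?_) ?_
    · gcongr
      exact hg.bound x
    · simpa using hf.decay.norm.mul_const C₂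

theorem CkBound.holderBound (h : CkBound k γ C f) : HolderBound γ C f := by
  cases k with
  | zero => exact h
  | succ k => exact h.1

theorem CkBound.nonneg (h : CkBound k γ C f) : 0 ≤ C := h.holderBound.nonneg

theorem CkBound.of_succ {F : Type} [NormedAddCommGroup F] [NormedSpace ℝ F] {f : E → F}
    (h : CkBound (k + 1) γ C f) : CkBound k γ C f := by
  induction k generalizing F with
  | zero => exact h.1
  | succ k ih => exact ⟨h.1, h.2.1, ih h.2.2⟩

theorem CkBound.of_le {l : ℕ} (h : CkBound k γ C f) (hl : l ≤ k) : CkBound l γ C f := by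
  induction k, hl using Nat.le_induction with
  | base => exact h
  | succ k _ ih => exact ih h.of_succ

theorem CkBound.mono {F : Type} [NormedAddCommGroup F] [NormedSpace ℝ F] {f : E → F}
    (h : CkBound k γ C₁ f) (hC : C₁ ≤ C₂) : CkBound k γ C₂ f := by
  induction k generalizing F with
  | zero => exact HolderBound.mono h hC
  | succ k ih => exact ⟨h.1.mono hC, h.2.1, ih h.2.2⟩

theorem CkBound.mono_exponent {F : Type} [NormedAddCommGroup F] [NormedSpace ℝ F] {f : E → F}
    {γ' : ℝ} (h : CkBound k γ C f) (h0 : 0 ≤ γ') (hγ : γ' ≤ γ) : CkBound k γ' (2 * C) f := by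
  induction k generalizing F with
  | zero => exact HolderBound.mono_exponent h h0 hγ
  | succ k ih => exact ⟨h.1.mono_exponent h0 hγ, h.2.1, ih h.2.2⟩

theorem CkBound.add {F : Type} [NormedAddCommGroup F] [NormedSpace ℝ F] {f g : E → F}
    (hf : CkBound k γ C₁ f) (hg : CkBound k γ C₂ g) :
    CkBound k γ (C₁ + C₂) (fun x => f x + g x) := by
  induction k generalizing F with
  | zero => exact HolderBound.add hf hg
  | succ k ih =>
    refine ⟨hf.1.add hg.1, hf.2.1.add hg.2.1, ?_⟩
    have : fderiv ℝ (fun x => f x + g x) = fun x => fderiv ℝ f x + fderiv ℝ g x :=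
      funext fun x => fderiv_fun_add (hf.2.1 x) (hg.2.1 x)
    rw [this]
    exact ih hf.2.2 hg.2.2

theorem CkBound.clm_comp {F G : Type} [NormedAddCommGroup F] [NormedSpace ℝ F]
    [NormedAddCommGroup G] [NormedSpace ℝ G] {f : E → F} (hf : CkBound k γ C f)
    (L : F →L[ℝ] G) (hL : ‖L‖ ≤ 1) : CkBound k γ C (fun x => L (f x)) := by
  induction k generalizing F G with
  | zero => exact HolderBound.clm_comp hf L hL
  | succ k ih =>
    refine ⟨hf.1.clm_comp L hL, L.differentiable.comp hf.2.1, ?_⟩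
    have : fderiv ℝ (fun x => L (f x)) =
        fun x => ContinuousLinearMap.compL ℝ E F G L (fderiv ℝ f x) :=
      funext fun x => (L.hasFDerivAt.comp x (hf.2.1 x).hasFDerivAt).fderiv
    rw [this]
    refine ih hf.2.2 _ (ContinuousLinearMap.opNorm_le_bound _ zero_le_one fun T => ?_)
    exact (L.opNorm_comp_le T).trans (by gcongr)

theorem CkBound.neg (hf : CkBound k γ C f) : CkBound k γ C (fun x => -f x) := by
  have := hf.clm_comp (-ContinuousLinearMap.id ℝ F)
    (by rw [norm_neg]; exact ContinuousLinearMap.norm_id_le)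
  simpa using this

theorem CkBound.sub {g : E → F} (hf : CkBound k γ C₁ f) (hg : CkBound k γ C₂ g) :
    CkBound k γ (C₁ + C₂) (fun x => f x - g x) := by
  simpa [sub_eq_add_neg] using hf.add hg.neg

theorem CkBound.zero (hC : 0 ≤ C) : CkBound k γ C (fun _ : E => (0 : F)) := by
  induction k generalizing F with
  | zero => exact ⟨by simpa using hC, fun x y => by simpa using by positivity, tendsto_const_nhds⟩
  | succ k ih =>
    refine ⟨⟨by simpa using hC, fun x y => by simpa using by positivity, tendsto_const_nhds⟩,
      differentiable_const _, ?_⟩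
    have : fderiv ℝ (fun _ : E => (0 : F)) = fun _ => 0 := funext fun x => fderiv_const_apply _
    rw [this]
    exact ih

/-- The Leibniz rule produces two products of one order less, so the constant doubles with each
order. -/
theorem CkBound.bilinear {F G H : Type} [NormedAddCommGroup F] [NormedSpace ℝ F]
    [NormedAddCommGroup G] [NormedSpace ℝ G] [NormedAddCommGroup H] [NormedSpace ℝ H]
    {f : E → F} {g : E → G} (hf : CkBound k γ C₁ f) (hg : CkBound k γ C₂ g)
    (L : F →L[ℝ] G →L[ℝ] H) (hL : ‖L‖ ≤ 1) :
    CkBound k γ (2 ^ (k + 1) * (C₁ * C₂)) (fun x => L (f x) (g x)) := by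
  induction k generalizing F G H with
  | zero =>
    rw [zero_add, pow_one]
    exact HolderBound.bilinear hf hg L hL
  | succ k ih =>
    have h12 := mul_nonneg hf.nonneg hg.nonneg
    refine ⟨(hf.1.bilinear hg.1 L hL).mono ?_,
      fun x => L.hasFDerivAt_of_bilinear (hf.2.1 x).hasFDerivAt (hg.2.1 x).hasFDerivAt
        |>.differentiableAt, ?_⟩
    · have : (2 : ℝ) ^ 1 ≤ 2 ^ (k + 1 + 1) := pow_le_pow_right₀ one_le_two (by omega)
      rw [pow_one] at this
      gcongr
    · have : fderiv ℝ (fun x => L (f x) (g x)) = fun x =>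
          L.precompR E (f x) (fderiv ℝ g x) + L.precompL E (fderiv ℝ f x) (g x) :=
        funext fun x =>
          (L.hasFDerivAt_of_bilinear (hf.2.1 x).hasFDerivAt (hg.2.1 x).hasFDerivAt).fderiv
      rw [this]
      have h1 := ih hf.of_succ hg.2.2 (L.precompR E) ((L.norm_precompR_le E).trans hL)
      have h2 := ih hf.2.2 hg.of_succ (L.precompL E) ((L.norm_precompL_le E).trans hL)
      refine (h1.add h2).mono (le_of_eq ?_)
      ring

theorem HolderBound.comp {Φ : E → E} {K : ℝ} (hf : HolderBound γ C f) (h0 : 0 ≤ γ) (h1 : γ ≤ 1)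
    (hK : 1 ≤ K) (hΦ : ∀ x y, ‖Φ x - Φ y‖ ≤ K * ‖x - y‖)
    (hΦ' : Tendsto Φ (Bornology.cobounded E) (Bornology.cobounded E)) :
    HolderBound γ (K * C) (fun x => f (Φ x)) where
  bound x := (hf.bound _).trans (by nlinarith [hf.nonneg])
  holder x y := by
    have hC := hf.nonneg
    calc _ ≤ C * ‖Φ x - Φ y‖ ^ γ := hf.holder _ _
      _ ≤ C * (K * ‖x - y‖) ^ γ := by gcongr; exact hΦ x y
      _ = C * (K ^ γ * ‖x - y‖ ^ γ) := by
        rw [Real.mul_rpow (by linarith) (norm_nonneg _)]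
      _ ≤ C * (K ^ (1 : ℝ) * ‖x - y‖ ^ γ) := by gcongr
      _ = _ := by rw [Real.rpow_one]; ring
  decay := hf.decay.comp hΦ'

/-- The chain rule is expanded so that the identity part of the inner derivative is absorbed: the
identity does not vanish at infinity and could not enter a `CkBound` as a factor. -/
theorem hasFDerivAt_comp_id_add {φ : E → E} {x : E} (hf : Differentiable ℝ f)
    (hφ : Differentiable ℝ φ) :
    HasFDerivAt (fun x => f (x + φ x)) (fderiv ℝ f (x + φ x) +
      ContinuousLinearMap.compL ℝ E E F (fderiv ℝ f (x + φ x)) (fderiv ℝ φ x)) x := by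
  have h := (hf (x + φ x)).hasFDerivAt.comp x ((hasFDerivAt_id x).add (hφ x).hasFDerivAt)
  convert! h using 1
  ext v
  simp

/-- The constant is fixed before `F` and `f`. The induction replaces `f` by its derivative, which
changes `F`, and later `f` runs through the time slices of a field without uniform bound. -/
theorem CkBound.comp (k : ℕ) {γ : ℝ} (h0 : 0 ≤ γ) (h1 : γ ≤ 1) {K : ℝ} (hK : 1 ≤ K)
    {C₂ : ℝ} (hC₂ : 0 ≤ C₂) :
    ∃ c : ℝ, 1 ≤ c ∧ ∀ {F : Type} [NormedAddCommGroup F] [NormedSpace ℝ F] {C : ℝ} {f : E → F}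
      {φ : E → E}, CkBound k γ C f → CkBound k γ C₂ φ →
      (∀ x y, ‖(x + φ x) - (y + φ y)‖ ≤ K * ‖x - y‖) →
      Tendsto (fun x => x + φ x) (Bornology.cobounded E) (Bornology.cobounded E) →
      CkBound k γ (c * C) (fun x => f (x + φ x)) := by
  induction k with
  | zero => exact ⟨K, hK, fun hf _ hΦ hΦ' => HolderBound.comp hf h0 h1 hK hΦ hΦ'⟩
  | succ k ih =>
    obtain ⟨c, hc, ih⟩ := ih
    have hpos : 0 ≤ c * (2 : ℝ) ^ (k + 1) * C₂ := by positivity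
    refine ⟨K + (c + c * 2 ^ (k + 1) * C₂), by linarith, fun {F _ _ C f φ} hf hφ hΦ hΦ' => ?_⟩
    have hC := hf.nonneg
    have hcC : 0 ≤ (c + c * 2 ^ (k + 1) * C₂) * C := by positivity
    refine ⟨(hf.1.comp h0 h1 hK hΦ hΦ').mono (by rw [add_mul]; linarith),
      fun x => (hasFDerivAt_comp_id_add hf.2.1 hφ.2.1).differentiableAt, ?_⟩
    rw [show fderiv ℝ (fun x => f (x + φ x)) = _ from
      funext fun x => (hasFDerivAt_comp_id_add hf.2.1 hφ.2.1).fderiv]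
    have hd := ih hf.2.2 hφ.of_succ hΦ hΦ'
    refine (hd.add (hd.bilinear hφ.2.2 (ContinuousLinearMap.compL ℝ E E F)
      (ContinuousLinearMap.norm_compL_le ℝ E E F))).mono ?_
    have : 0 ≤ K * C := by positivity
    nlinarith

/-- Composition from the right is Hölder continuous. -/
theorem CkBound.comp_sub_comp (k : ℕ) {γ : ℝ} (h0 : 0 ≤ γ) {K : ℝ} (hK : 1 ≤ K)
    {C₂ : ℝ} (hC₂ : 0 ≤ C₂) :
    ∃ c : ℝ, 1 ≤ c ∧ ∀ {F : Type} [NormedAddCommGroup F] [NormedSpace ℝ F] {C δ : ℝ} {f : E → F}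
      {φ ψ : E → E}, CkBound k γ C f → CkBound k 0 C₂ φ → CkBound k 0 C₂ ψ →
      (∀ x y, ‖(x + φ x) - (y + φ y)‖ ≤ K * ‖x - y‖) →
      (∀ x y, ‖(x + ψ x) - (y + ψ y)‖ ≤ K * ‖x - y‖) →
      Tendsto (fun x => x + φ x) (Bornology.cobounded E) (Bornology.cobounded E) →
      Tendsto (fun x => x + ψ x) (Bornology.cobounded E) (Bornology.cobounded E) →
      (∀ x, ‖φ x - ψ x‖ ^ γ ≤ δ) → CkBound k 0 δ (fun x => φ x - ψ x) →
      CkBound k 0 (c * (C * δ)) (fun x => f (x + φ x) - f (x + ψ x)) := by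
  -- The Hölder condition on `f`, applied at the two image points, gives smallness only pointwise.
  -- This is why the conclusion has exponent `0`; the oscillation costs the factor `2`.
  have base : ∀ {F : Type} [NormedAddCommGroup F] [NormedSpace ℝ F] {C δ : ℝ} {f : E → F}
      {φ ψ : E → E}, HolderBound γ C f →
      Tendsto (fun x => x + φ x) (Bornology.cobounded E) (Bornology.cobounded E) →
      Tendsto (fun x => x + ψ x) (Bornology.cobounded E) (Bornology.cobounded E) →
      (∀ x, ‖φ x - ψ x‖ ^ γ ≤ δ) →
      HolderBound 0 (2 * (C * δ)) (fun x => f (x + φ x) - f (x + ψ x)) := by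
    intro F _ _ C δ f φ ψ hf hφ hψ hδ
    have hC := hf.nonneg
    have hδ0 : 0 ≤ δ := (Real.rpow_nonneg (norm_nonneg _) _).trans (hδ 0)
    have key : ∀ x, ‖f (x + φ x) - f (x + ψ x)‖ ≤ C * δ := fun x => by
      refine (hf.holder _ _).trans ?_
      rw [add_sub_add_left_eq_sub]
      gcongr
      exact hδ x
    refine ⟨fun x => (key x).trans (by nlinarith [mul_nonneg hC hδ0]), fun x y => ?_, ?_⟩
    · rw [Real.rpow_zero, mul_one, two_mul]
      exact (norm_sub_le _ _).trans (add_le_add (key x) (key y))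
    · simpa using (hf.decay.comp hφ).sub (hf.decay.comp hψ)
  induction k with
  | zero => exact ⟨2, one_le_two, fun hf _ _ _ _ hφ' hψ' hδ _ => base hf hφ' hψ' hδ⟩
  | succ k ih =>
    obtain ⟨c, hc, ih⟩ := ih
    obtain ⟨c', hc', hcomp⟩ := CkBound.comp (E := E) k le_rfl zero_le_one hK hC₂
    have hpos : 0 ≤ c * (2 : ℝ) ^ (k + 1) * C₂ := by positivity
    have hpos' : 0 ≤ 2 ^ (k + 1) * (c' * 2) := by positivity
    refine ⟨2 + (c + c * 2 ^ (k + 1) * C₂ + 2 ^ (k + 1) * (c' * 2)), by linarith,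
      fun {F _ _ C δ f φ ψ} hf hφ hψ hΦ hΨ hΦ' hΨ' hδ hφψ => ?_⟩
    have hC := hf.nonneg
    have hδ0 := hφψ.nonneg
    have hCδ := mul_nonneg hC hδ0
    have hcC : 0 ≤ (c + c * 2 ^ (k + 1) * C₂ + 2 ^ (k + 1) * (c' * 2)) * (C * δ) := by positivity
    refine ⟨(base hf.1 hΦ' hΨ' hδ).mono (by nlinarith),
      fun x => ((hasFDerivAt_comp_id_add hf.2.1 hφ.2.1).sub
        (hasFDerivAt_comp_id_add hf.2.1 hψ.2.1)).differentiableAt, ?_⟩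
    -- Telescoping: either the outer derivative is compared at the two points, where the induction
    -- hypothesis applies, or the factors `fderiv ℝ φ` and `fderiv ℝ ψ` are compared, where the
    -- bound on `φ - ψ` applies.
    have hfd : fderiv ℝ (fun x => f (x + φ x) - f (x + ψ x)) = fun x =>
        ((fderiv ℝ f (x + φ x) - fderiv ℝ f (x + ψ x)) +
          ContinuousLinearMap.compL ℝ E E F (fderiv ℝ f (x + φ x) - fderiv ℝ f (x + ψ x))
            (fderiv ℝ φ x)) +
          ContinuousLinearMap.compL ℝ E E F (fderiv ℝ f (x + ψ x))
            (fderiv ℝ (fun x => φ x - ψ x) x) := by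
      funext x
      rw [((hasFDerivAt_comp_id_add hf.2.1 hφ.2.1).fun_sub
        (hasFDerivAt_comp_id_add hf.2.1 hψ.2.1)).fderiv, fderiv_fun_sub (hφ.2.1 x) (hψ.2.1 x)]
      simp only [map_sub, _root_.sub_apply]
      abel
    rw [hfd]
    have hd := ih hf.2.2 hφ.of_succ hψ.of_succ hΦ hΨ hΦ' hΨ' hδ hφψ.of_succ
    have hψd := hcomp (hf.2.2.mono_exponent le_rfl h0) hψ.of_succ hΨ hΨ'
    have hL := ContinuousLinearMap.norm_compL_le ℝ E E F
    refine ((hd.add (hd.bilinear hφ.2.2 _ hL)).add (hψd.bilinear hφψ.2.2 _ hL)).mono ?_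
    nlinarith

/-- Split an increment as its power `α / β` times its power `1 - α / β`; estimate the first factor
by the Hölder bound and the second by the oscillation bound. -/
theorem HolderBound.interpolate {α β A B : ℝ} (hα : 0 < α) (hαβ : α < β) (hA : HolderBound β A f)
    (hB : HolderBound 0 B f) (hBC : B ≤ C) (hC : A ^ (α / β) * B ^ (1 - α / β) ≤ C) :
    HolderBound α C f where
  bound x := (hB.bound x).trans hBC
  holder x y := by
    have h1 := hA.holder x y
    have h2 := hB.holder x y
    rw [Real.rpow_zero, mul_one] at h2
    have hβ : 0 < β := hα.trans hαβ
    have hθ : 0 ≤ 1 - α / β := by rw [sub_nonneg, div_le_one hβ]; exact hαβ.le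
    calc ‖f x - f y‖ = ‖f x - f y‖ ^ (α / β) * ‖f x - f y‖ ^ (1 - α / β) := by
          rw [← Real.rpow_add_of_nonneg (norm_nonneg _) (by positivity) hθ]
          simp
      _ ≤ (A * ‖x - y‖ ^ β) ^ (α / β) * B ^ (1 - α / β) := by
          have := (norm_nonneg _).trans h1
          gcongr
      _ = A ^ (α / β) * B ^ (1 - α / β) * ‖x - y‖ ^ α := by
          rw [Real.mul_rpow hA.nonneg (by positivity), ← Real.rpow_mul (norm_nonneg _),
            mul_div_cancel₀ _ hβ.ne']
          ring
      _ ≤ _ := by gcongr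
  decay := hA.decay

theorem CkBound.interpolate {F : Type} [NormedAddCommGroup F] [NormedSpace ℝ F] {f : E → F}
    {α β A B : ℝ} (hα : 0 < α) (hαβ : α < β) (hA : CkBound k β A f)
    (hB : CkBound k 0 B f) (hBC : B ≤ C) (hC : A ^ (α / β) * B ^ (1 - α / β) ≤ C) :
    CkBound k α C f := by
  induction k generalizing F with
  | zero => exact HolderBound.interpolate hα hαβ hA hB hBC hC
  | succ k ih => exact ⟨hA.1.interpolate hα hαβ hB.1 hBC hC, hA.2.1, ih hA.2.2 hB.2.2⟩

end Bounds

/-! ### Comparison of `CkBound` with the Hölder norm. -/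

section Norm

variable {E : Type} [NormedAddCommGroup E] [NormedSpace ℝ E] {k : ℕ} {γ C : ℝ}

theorem norm_iteratedFDeriv_succ_sub {F : Type} [NormedAddCommGroup F] [NormedSpace ℝ F]
    (f : E → F) (x y : E) :
    ‖iteratedFDeriv ℝ (k + 1) f x - iteratedFDeriv ℝ (k + 1) f y‖ =
      ‖iteratedFDeriv ℝ k (fderiv ℝ f) x - iteratedFDeriv ℝ k (fderiv ℝ f) y‖ := by
  rw [← dist_eq_norm, ← dist_eq_norm, iteratedFDeriv_succ_eq_comp_right,
    iteratedFDeriv_succ_eq_comp_right, Function.comp_apply, Function.comp_apply,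
    LinearIsometryEquiv.dist_map]

/-- `CkBound` asks for a Hölder bound at every order, the norm only at the top. Below the top, the
mean value inequality makes each derivative Lipschitz, and lowering the exponent from `1` to `γ`
costs the factor `2`. -/
theorem ckBound_of_iteratedFDeriv {F : Type} [NormedAddCommGroup F] [NormedSpace ℝ F] {f : E → F}
    (h0 : 0 ≤ γ) (h1 : γ ≤ 1) (hf : ContDiff ℝ k f)
    (hb : ∀ l ≤ k, ∀ x, ‖iteratedFDeriv ℝ l f x‖ ≤ C)
    (hh : ∀ x y, ‖iteratedFDeriv ℝ k f x - iteratedFDeriv ℝ k f y‖ ≤ C * ‖x - y‖ ^ γ)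
    (hd : ∀ l ≤ k, Tendsto (iteratedFDeriv ℝ l f) (Bornology.cobounded E) (𝓝 0)) :
    CkBound k γ (2 * C) f := by
  have hC : 0 ≤ C := (norm_nonneg _).trans (hb 0 (Nat.zero_le k) 0)
  have hb0 : ∀ x, ‖f x‖ ≤ C := fun x => by simpa using hb 0 (Nat.zero_le k) x
  have hd0 : Tendsto f (Bornology.cobounded E) (𝓝 0) := by
    rw [tendsto_zero_iff_norm_tendsto_zero]
    simpa using (hd 0 (Nat.zero_le k)).norm
  induction k generalizing F with
  | zero =>
    have h2 : HolderBound γ C f := ⟨hb0, fun x y => by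
      have := hh x y
      rwa [iteratedFDeriv_zero_eq_comp, Function.comp_apply, Function.comp_apply, ← map_sub,
        LinearIsometryEquiv.norm_map] at this, hd0⟩
    exact HolderBound.mono h2 (by linarith)
  | succ k ih =>
    have hdiff : Differentiable ℝ f := hf.differentiable (by simp)
    have hfd : ∀ x, ‖fderiv ℝ f x‖ ≤ C := fun x => by
      have := hb 1 (by omega) x
      rwa [← norm_iteratedFDeriv_fderiv, norm_iteratedFDeriv_zero] at this
    have h2 : HolderBound 1 C f := ⟨hb0, fun x y => by
      rw [Real.rpow_one]
      exact convex_univ.norm_image_sub_le_of_norm_fderiv_le (fun z _ => hdiff z)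
        (fun z _ => hfd z) (mem_univ y) (mem_univ x), hd0⟩
    refine ⟨h2.mono_exponent h0 h1, hdiff, ?_⟩
    refine ih ((contDiff_succ_iff_fderiv.1 (by exact_mod_cast hf)).2.2) (fun l hl x => ?_)
      (fun x y => ?_) (fun l hl => ?_) hfd ?_
    · rw [norm_iteratedFDeriv_fderiv]
      exact hb (l + 1) (by omega) x
    · have := hh x y
      rwa [norm_iteratedFDeriv_succ_sub] at this
    · rw [tendsto_zero_iff_norm_tendsto_zero]
      simp_rw [norm_iteratedFDeriv_fderiv]
      exact tendsto_zero_iff_norm_tendsto_zero.1 (hd (l + 1) (by omega))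
    · rw [tendsto_zero_iff_norm_tendsto_zero]
      have := tendsto_zero_iff_norm_tendsto_zero.1 (hd 1 (by omega))
      simp_rw [← norm_iteratedFDeriv_fderiv, norm_iteratedFDeriv_zero] at this
      exact this

theorem HolderBound.continuous {F : Type} [NormedAddCommGroup F] [NormedSpace ℝ F] {f : E → F}
    (hγ : 0 < γ) (hf : HolderBound γ C f) : Continuous f := by
  have : HolderWith C.toNNReal γ.toNNReal f := fun x y => by
    rw [edist_dist, edist_dist, Real.coe_toNNReal _ hγ.le,
      ENNReal.ofReal_rpow_of_nonneg dist_nonneg hγ.le, ← ENNReal.ofReal.eq_1 C,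
      ← ENNReal.ofReal_mul hf.nonneg, dist_eq_norm, dist_eq_norm]
    exact ENNReal.ofReal_le_ofReal (hf.holder x y)
  exact this.continuous (by simpa using hγ)

theorem CkBound.contDiff {F : Type} [NormedAddCommGroup F] [NormedSpace ℝ F] {f : E → F}
    (hγ : 0 < γ) (hf : CkBound k γ C f) : ContDiff ℝ k f := by
  induction k generalizing F with
  | zero => exact contDiff_zero.2 (HolderBound.continuous hγ hf)
  | succ k ih =>
    push_cast
    exact contDiff_succ_iff_fderiv.2 ⟨hf.2.1, by simp, ih hf.2.2⟩

theorem CkBound.norm_iteratedFDeriv_le {F : Type} [NormedAddCommGroup F] [NormedSpace ℝ F]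
    {f : E → F} (hf : CkBound k γ C f) {l : ℕ} (hl : l ≤ k) (x : E) :
    ‖iteratedFDeriv ℝ l f x‖ ≤ C := by
  induction l generalizing F k with
  | zero => simpa using hf.holderBound.bound x
  | succ l ih =>
    obtain ⟨k, rfl⟩ := Nat.exists_eq_add_of_le' hl
    have h := hf.of_le (l := k + l + 1) (by omega)
    rw [← norm_iteratedFDeriv_fderiv]
    exact ih h.2.2 (by omega)

theorem CkBound.tendsto_iteratedFDeriv {F : Type} [NormedAddCommGroup F] [NormedSpace ℝ F]
    {f : E → F} (hf : CkBound k γ C f) {l : ℕ} (hl : l ≤ k) :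
    Tendsto (iteratedFDeriv ℝ l f) (Bornology.cobounded E) (𝓝 0) := by
  rw [tendsto_zero_iff_norm_tendsto_zero]
  induction l generalizing F k with
  | zero => simpa using hf.holderBound.decay.norm
  | succ l ih =>
    obtain ⟨k, rfl⟩ := Nat.exists_eq_add_of_le' hl
    have h := hf.of_le (l := k + l + 1) (by omega)
    simp_rw [← norm_iteratedFDeriv_fderiv]
    exact ih h.2.2 (by omega)

theorem CkBound.norm_iteratedFDeriv_sub_le {F : Type} [NormedAddCommGroup F] [NormedSpace ℝ F]
    {f : E → F} (hf : CkBound k γ C f) (x y : E) :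
    ‖iteratedFDeriv ℝ k f x - iteratedFDeriv ℝ k f y‖ ≤ C * ‖x - y‖ ^ γ := by
  induction k generalizing F with
  | zero =>
    rw [iteratedFDeriv_zero_eq_comp, Function.comp_apply, Function.comp_apply, ← map_sub,
        LinearIsometryEquiv.norm_map]
    exact HolderBound.holder hf x y
  | succ k ih =>
    rw [norm_iteratedFDeriv_succ_sub]
    exact ih hf.2.2

theorem CkBound.eCkHolderNorm_le {F : Type} [NormedAddCommGroup F] [NormedSpace ℝ F]
    {f : E → F} {γ : ℝ≥0} (hf : CkBound k γ C f) : eCkHolderNorm k γ f ≤ ENNReal.ofReal C := by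
  refine max_le (iSup_le fun l => iSup_le fun hl => iSup_le fun x => ?_) ?_
  · rw [← ofReal_norm]
    exact ENNReal.ofReal_le_ofReal (hf.norm_iteratedFDeriv_le hl x)
  · refine HolderWith.eHolderNorm_le fun x y => ?_
    rw [edist_dist, edist_dist, ENNReal.ofReal_rpow_of_nonneg dist_nonneg γ.coe_nonneg,
      ← ENNReal.ofReal.eq_1 C, ← ENNReal.ofReal_mul hf.nonneg, dist_eq_norm,
      dist_eq_norm]
    exact ENNReal.ofReal_le_ofReal (hf.norm_iteratedFDeriv_sub_le x y)

/-- A function with controlled derivatives as an element of the Hölder space. -/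
def CkBound.toHolderZero {F : Type} [NormedAddCommGroup F] [NormedSpace ℝ F]
    {f : E → F} {γ : ℝ≥0} (hγ : 0 < γ) (hf : CkBound k γ C f) : HolderZero E F k γ :=
  ⟨f, hf.contDiff (by exact_mod_cast hγ), hf.eCkHolderNorm_le.trans_lt ENNReal.ofReal_lt_top,
    fun _ hl => hf.tendsto_iteratedFDeriv hl⟩

theorem HolderZero.norm_le {F : Type} [NormedAddCommGroup F] [NormedSpace ℝ F] {γ : ℝ≥0}
    {f : HolderZero E F k γ} (hf : CkBound k γ C (f : E → F)) : ‖f‖ ≤ C := by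
  rw [HolderZero.norm_def]
  exact ENNReal.toReal_le_of_le_ofReal hf.nonneg hf.eCkHolderNorm_le

theorem HolderZero.ckBound {F : Type} [NormedAddCommGroup F] [NormedSpace ℝ F] {γ : ℝ≥0}
    (hγ : γ ≤ 1) (f : HolderZero E F k γ) : CkBound k γ (2 * ‖f‖) (f : E → F) := by
  have hfin := f.2.2.1.ne
  refine ckBound_of_iteratedFDeriv γ.2 (by exact_mod_cast hγ) f.2.1 (fun l hl x => ?_)
    (fun x y => ?_) f.2.2.2
  · rw [← toReal_enorm]
    exact ENNReal.toReal_mono hfin (enorm_iteratedFDeriv_le hl γ f x)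
  · have hle : eHolderNorm γ (iteratedFDeriv ℝ k (f : E → F)) ≤ eCkHolderNorm k γ (f : E → F) :=
      le_max_right _ _
    have hmem : MemHolder γ (iteratedFDeriv ℝ k (f : E → F)) :=
      eHolderNorm_lt_top.1 (hle.trans_lt f.2.2.1)
    have h1 := hmem.holderWith.dist_le x y
    rw [dist_eq_norm, dist_eq_norm] at h1
    refine h1.trans ?_
    gcongr
    rw [HolderZero.norm_def]
    have := ENNReal.toReal_mono hfin hle
    rwa [← hmem.coe_nnHolderNorm_eq_eHolderNorm] at this

end Norm

/-! ### Gronwall inequalities and Picard iteration with an integrable kernel. -/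

section Gronwall

/-- Lebesgue measure on the unit interval. -/
noncomputable abbrev unitVolume : Measure ℝ := volume.restrict (Icc (0 : ℝ) 1)

variable {X : Type} [NormedAddCommGroup X] [NormedSpace ℝ X] {m : ℝ → ℝ} {R : ℝ}

theorem intervalIntegrable_of_integrable {f : ℝ → X} (hf : Integrable f unitVolume) {a b : ℝ}
    (ha : a ∈ Icc (0 : ℝ) 1) (hb : b ∈ Icc (0 : ℝ) 1) : IntervalIntegrable f volume a b := by
  rw [intervalIntegrable_iff]
  refine IntegrableOn.mono_set hf (uIoc_subset_uIcc.trans ?_)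
  exact uIcc_subset_Icc ha hb

theorem ae_of_ae_unitVolume {p : ℝ → Prop} (h : ∀ᵐ s ∂unitVolume, p s) {a b : ℝ}
    (ha : 0 ≤ a) (hb : b ≤ 1) : ∀ᵐ s, s ∈ Ioc a b → p s := by
  have := (ae_restrict_iff' measurableSet_Icc).1 h
  filter_upwards [this] with s hs h'
  exact hs ⟨ha.trans h'.1.le, h'.2.trans hb⟩

theorem norm_intervalIntegral_le {f : ℝ → X} {q : ℝ → ℝ} (hq : Integrable q unitVolume)
    (h : ∀ᵐ s ∂unitVolume, ‖f s‖ ≤ q s) {a b : ℝ} (ha : a ∈ Icc (0 : ℝ) 1)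
    (hb : b ∈ Icc (0 : ℝ) 1) (hab : a ≤ b) : ‖∫ s in a..b, f s‖ ≤ ∫ s in a..b, q s :=
  intervalIntegral.norm_integral_le_of_norm_le hab (ae_of_ae_unitVolume h ha.1 hb.2)
    (intervalIntegrable_of_integrable hq ha hb)

theorem intervalIntegral_le_integral {q : ℝ → ℝ} (hq : Integrable q unitVolume)
    (h0 : ∀ s, 0 ≤ q s) {a b : ℝ} (ha : a ∈ Icc (0 : ℝ) 1)
    (hb : b ∈ Icc (0 : ℝ) 1) (hab : a ≤ b) : ∫ s in a..b, q s ≤ ∫ s, q s ∂unitVolume := by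
  rw [intervalIntegral.integral_of_le hab]
  exact setIntegral_mono_set hq (ae_of_all _ h0)
    (Eventually.of_forall fun s hs => ⟨ha.1.trans hs.1.le, hs.2.trans hb.2⟩)

theorem continuousOn_primitive_unit {f : ℝ → X} (hf : Integrable f unitVolume) :
    ContinuousOn (fun t => ∫ s in (0 : ℝ)..t, f s) (Icc 0 1) := by
  have := intervalIntegral.continuousOn_primitive_interval (μ := volume) (f := f) (a := 0) (b := 1)
    (by rwa [uIcc_of_le zero_le_one])
  rwa [uIcc_of_le zero_le_one] at this

theorem primitive_mono (hm : Integrable m unitVolume) (hm0 : ∀ s, 0 ≤ m s) :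
    MonotoneOn (fun t => ∫ s in (0 : ℝ)..t, m s) (Icc 0 1) := fun a ha b hb hab => by
  have h0 : (0 : ℝ) ∈ Icc (0 : ℝ) 1 := by simp
  have := intervalIntegral.integral_add_adjacent_intervals
    (intervalIntegrable_of_integrable hm h0 ha) (intervalIntegrable_of_integrable hm ha hb)
  have h2 := intervalIntegral.integral_nonneg (μ := volume) hab (fun s _ => hm0 s)
  dsimp only
  linarith

/-- By Lebesgue differentiation the integrand is almost everywhere the derivative of `exp (c M) /
c`, which is monotone for either sign of `c`. The integral of the derivative of a monotone function
is at most its increment, so absolute continuity of the exponential is not needed. -/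
theorem integral_mul_exp_primitive_le (hm : Integrable m unitVolume) (hm0 : ∀ s, 0 ≤ m s)
    {c : ℝ} (hc : c ≠ 0) {a b : ℝ} (ha : a ∈ Icc (0 : ℝ) 1) (hb : b ∈ Icc (0 : ℝ) 1)
    (hab : a ≤ b) :
    ∫ s in a..b, m s * Real.exp (c * ∫ r in (0 : ℝ)..s, m r) ≤
      Real.exp (c * ∫ r in (0 : ℝ)..b, m r) / c - Real.exp (c * ∫ r in (0 : ℝ)..a, m r) / c := by
  set M : ℝ → ℝ := fun t => ∫ r in (0 : ℝ)..t, m r with hM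
  have h01 : (0 : ℝ) ∈ Icc (0 : ℝ) 1 := by simp
  have hmono : MonotoneOn (fun t => Real.exp (c * M t) / c) (uIcc a b) := by
    rw [uIcc_of_le hab]
    intro x hx y hy hxy
    have hxy' := primitive_mono hm hm0 (Icc_subset_Icc ha.1 hb.2 hx) (Icc_subset_Icc ha.1 hb.2 hy)
      hxy
    dsimp only
    rcases lt_or_gt_of_ne hc with hc | hc
    · rw [div_le_div_right_of_neg hc, Real.exp_le_exp]
      exact mul_le_mul_of_nonpos_left hxy' hc.le
    · gcongr
  have h1 := hmono.intervalIntegral_deriv_mem_uIcc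
  rw [uIcc_of_le (sub_nonneg.2 (hmono left_mem_uIcc right_mem_uIcc hab))] at h1
  refine le_trans (le_of_eq ?_) h1.2
  refine intervalIntegral.integral_congr_ae ?_
  have h2 := (intervalIntegrable_of_integrable hm h01
    (right_mem_Icc.2 zero_le_one)).ae_hasDerivAt_integral
  filter_upwards [h2] with s hs hs'
  rw [uIoc_of_le hab] at hs'
  have hs01 : s ∈ uIcc (0 : ℝ) 1 := by
    rw [uIcc_of_le zero_le_one]
    exact ⟨ha.1.trans hs'.1.le, hs'.2.trans hb.2⟩
  have h3 : HasDerivAt M (m s) s := hs hs01 0 left_mem_uIcc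
  rw [((h3.const_mul c).exp.div_const c).deriv]
  field_simp
  rfl

theorem integrable_mul_of_continuousOn {g : ℝ → ℝ} (hm : Integrable m unitVolume)
    (hg : ContinuousOn g (Icc 0 1)) : Integrable (fun s => m s * g s) unitVolume :=
  IntegrableOn.mul_continuousOn hm hg isCompact_Icc

/-- Gronwall's inequality with an integrable kernel. -/
theorem gronwall {g : ℝ → ℝ} {a : ℝ} (hm : Integrable m unitVolume) (hm0 : ∀ s, 0 ≤ m s)
    (hR : ∫ s, m s ∂unitVolume ≤ R) (hg : ContinuousOn g (Icc 0 1)) (ha : 0 ≤ a)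
    (h : ∀ t ∈ Icc (0 : ℝ) 1, g t ≤ a + ∫ s in (0 : ℝ)..t, m s * g s) :
    ∀ t ∈ Icc (0 : ℝ) 1, g t ≤ 2 * Real.exp (2 * R) * a := by
  intro t ht
  set M : ℝ → ℝ := fun t => ∫ r in (0 : ℝ)..t, m r with hM
  have h01 : (0 : ℝ) ∈ Icc (0 : ℝ) 1 := by simp
  have hMc : ContinuousOn M (Icc 0 1) := continuousOn_primitive_unit hm
  have hMR : M t ≤ R := (intervalIntegral_le_integral hm hm0 h01 ht ht.1).trans hR
  have hwc : ContinuousOn (fun s => Real.exp (2 * M s)) (Icc 0 1) := by fun_prop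
  -- Let `K` be the maximum of `g` relative to the weight `exp (2 M)`. The factor `2` in the weight
  -- makes the integral operator contract by `1 / 2`, so the hypothesis at the maximum point `t₀`
  -- bounds `K` by a multiple of `a`.
  obtain ⟨t₀, ht₀, hmax⟩ := isCompact_Icc.exists_isMaxOn ⟨0, h01⟩
    (show ContinuousOn (fun s => g s / Real.exp (2 * M s)) (Icc 0 1) from
      hg.div hwc fun s _ => (Real.exp_pos _).ne')
  set K := g t₀ / Real.exp (2 * M t₀) with hK
  have hgK : ∀ s ∈ Icc (0 : ℝ) 1, g s ≤ K * Real.exp (2 * M s) := fun s hs =>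
    (div_le_iff₀ (Real.exp_pos _)).1 (hmax hs)
  have h1 : g t₀ ≤ a + K * (Real.exp (2 * M t₀) / 2 - 1 / 2) ∨ K ≤ 0 := by
    by_cases hK0 : K ≤ 0
    · exact Or.inr hK0
    · left
      refine (h t₀ ht₀).trans ?_
      gcongr
      have h2 := integral_mul_exp_primitive_le hm hm0 two_ne_zero h01 ht₀ ht₀.1
      rw [intervalIntegral.integral_same, mul_zero, Real.exp_zero] at h2
      calc _ ≤ ∫ s in (0 : ℝ)..t₀, K * (m s * Real.exp (2 * M s)) := by
            refine intervalIntegral.integral_mono_on ht₀.1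
              (intervalIntegrable_of_integrable (integrable_mul_of_continuousOn hm hg) h01 ht₀)
              ((intervalIntegrable_of_integrable
                (integrable_mul_of_continuousOn hm hwc) h01 ht₀).const_mul K) fun s hs => ?_
            have := mul_le_mul_of_nonneg_left (hgK s ⟨hs.1, hs.2.trans ht₀.2⟩) (hm0 s)
            linarith
        _ = K * ∫ s in (0 : ℝ)..t₀, m s * Real.exp (2 * M s) :=
            intervalIntegral.integral_const_mul _ _
        _ ≤ _ := mul_le_mul_of_nonneg_left h2 (not_le.1 hK0).le
  have hKa : K ≤ 2 * a := by
    rcases h1 with h1 | h1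
    · have h2 : g t₀ = K * Real.exp (2 * M t₀) := by
        rw [hK, div_mul_cancel₀ _ (Real.exp_pos _).ne']
      by_contra! h3
      have h4 : 1 ≤ Real.exp (2 * M t₀) := by
        refine Real.one_le_exp ?_
        have := intervalIntegral.integral_nonneg (μ := volume) ht₀.1 (fun s _ => hm0 s)
        positivity
      nlinarith
    · linarith
  calc g t ≤ K * Real.exp (2 * M t) := hgK t ht
    _ ≤ 2 * a * Real.exp (2 * R) := by gcongr
    _ = _ := by ring

/-- The weight is now decreasing. A positive maximum `K` of the quotient would be at most half of
itself minus a positive term. The lemma serves to show that a solution of a linear equation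
vanishing at one time has vanished before. -/
theorem backward_gronwall {g : ℝ → ℝ} (hm : Integrable m unitVolume) (hm0 : ∀ s, 0 ≤ m s)
    (hg : ContinuousOn g (Icc 0 1)) {t : ℝ} (ht : t ∈ Icc (0 : ℝ) 1)
    (h : ∀ τ ∈ Icc (0 : ℝ) t, g τ ≤ ∫ s in τ..t, m s * g s) :
    ∀ τ ∈ Icc (0 : ℝ) t, g τ ≤ 0 := by
  intro τ hτ
  set M : ℝ → ℝ := fun t => ∫ r in (0 : ℝ)..t, m r with hM
  have h01 : (0 : ℝ) ∈ Icc (0 : ℝ) 1 := by simp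
  have hsub : Icc (0 : ℝ) t ⊆ Icc 0 1 := Icc_subset_Icc_right ht.2
  have hMc : ContinuousOn M (Icc 0 1) := continuousOn_primitive_unit hm
  have hwc : ContinuousOn (fun s => Real.exp (-2 * M s)) (Icc 0 1) := by fun_prop
  obtain ⟨t₀, ht₀, hmax⟩ := isCompact_Icc.exists_isMaxOn ⟨τ, hτ⟩
    (show ContinuousOn (fun s => g s / Real.exp (-2 * M s)) (Icc 0 t) from
      (hg.div hwc fun s _ => (Real.exp_pos _).ne').mono hsub)
  set K := g t₀ / Real.exp (-2 * M t₀) with hK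
  have hgK : ∀ s ∈ Icc (0 : ℝ) t, g s ≤ K * Real.exp (-2 * M s) := fun s hs =>
    (div_le_iff₀ (Real.exp_pos _)).1 (hmax hs)
  suffices hK0 : K ≤ 0 from
    (hgK τ hτ).trans (mul_nonpos_of_nonpos_of_nonneg hK0 (Real.exp_pos _).le)
  by_contra! hK0
  have h2 := integral_mul_exp_primitive_le hm hm0 (c := -2) (by norm_num) (hsub ht₀) ht ht₀.2
  have h3 : g t₀ ≤ K * (Real.exp (-2 * M t) / (-2) - Real.exp (-2 * M t₀) / (-2)) := by
    refine (h t₀ ht₀).trans ?_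
    calc _ ≤ ∫ s in t₀..t, K * (m s * Real.exp (-2 * M s)) := by
          refine intervalIntegral.integral_mono_on ht₀.2
            (intervalIntegrable_of_integrable (integrable_mul_of_continuousOn hm hg) (hsub ht₀) ht)
            ((intervalIntegrable_of_integrable
              (integrable_mul_of_continuousOn hm hwc) (hsub ht₀) ht).const_mul K) fun s hs => ?_
          have := mul_le_mul_of_nonneg_left (hgK s ⟨ht₀.1.trans hs.1, hs.2⟩) (hm0 s)
          linarith
      _ = K * ∫ s in t₀..t, m s * Real.exp (-2 * M s) :=
          intervalIntegral.integral_const_mul _ _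
      _ ≤ _ := mul_le_mul_of_nonneg_left h2 hK0.le
  have h4 : g t₀ = K * Real.exp (-2 * M t₀) := by
    rw [hK, div_mul_cancel₀ _ (Real.exp_pos _).ne']
  have h5 := Real.exp_pos (-2 * M t)
  have h6 := Real.exp_pos (-2 * M t₀)
  nlinarith [mul_pos hK0 h5, mul_pos hK0 h6]

/-- Existence of solutions of Carathéodory equations with an integrable Lipschitz constant. -/
theorem exists_integral_solution [CompleteSpace X] {G : ℝ → X → X} (x₀ : X)
    (hm : Integrable m unitVolume) (hm0 : ∀ s, 0 ≤ m s)
    (hint : ∀ c : ℝ → X, Continuous c → Integrable (fun s => G s (c s)) unitVolume)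
    (hlip : ∀ᵐ s ∂unitVolume, ∀ x y, ‖G s x - G s y‖ ≤ m s * ‖x - y‖) :
    ∃ c : ℝ → X, Continuous c ∧
      ∀ t ∈ Icc (0 : ℝ) 1, c t = x₀ + ∫ s in (0 : ℝ)..t, G s (c s) := by
  set M : ℝ → ℝ := fun t => ∫ r in (0 : ℝ)..t, m r with hM
  have h01 : (0 : ℝ) ∈ Icc (0 : ℝ) 1 := by simp
  have h11 : (1 : ℝ) ∈ Icc (0 : ℝ) 1 := by simp
  have hMc : ContinuousOn M (Icc 0 1) := continuousOn_primitive_unit hm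
  have hwc : ContinuousOn (fun s => Real.exp (2 * M s)) (Icc 0 1) := by fun_prop
  let ext : C(Icc (0 : ℝ) 1, X) → ℝ → X := fun c => IccExtend zero_le_one c
  have hext : ∀ c, Continuous (ext c) := fun c => c.continuous.Icc_extend'
  let T : C(Icc (0 : ℝ) 1, X) → C(Icc (0 : ℝ) 1, X) := fun c =>
    ⟨fun t => x₀ + ∫ s in (0 : ℝ)..t, G s (ext c s),
      continuous_const.add
        (continuousOn_iff_continuous_domRestrict.1 (continuousOn_primitive_unit (hint _ (hext c))))⟩
  -- `T` halves distances in the norm weighted by `exp (2 M)`. Keeping the weight inside the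
  -- estimate of the iterates avoids a change of norm: some iterate contracts in the usual sup norm.
  have hT : ∀ (j : ℕ) (c c' : C(Icc (0 : ℝ) 1, X)) (t : Icc (0 : ℝ) 1),
      ‖T^[j] c t - T^[j] c' t‖ ≤ dist c c' / 2 ^ j * Real.exp (2 * M t) := by
    intro j c c'
    induction j with
    | zero =>
      intro t
      have h1 : 1 ≤ Real.exp (2 * M t) := by
        refine Real.one_le_exp ?_
        have := intervalIntegral.integral_nonneg (μ := volume) t.2.1 (fun s _ => hm0 s)
        positivity
      have h2 := ContinuousMap.dist_apply_le_dist (f := c) (g := c') t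
      rw [dist_eq_norm] at h2
      simp only [Function.iterate_zero, id_eq, pow_zero, div_one]
      nlinarith [dist_nonneg (x := c) (y := c')]
    | succ j ih =>
      intro t
      rw [Function.iterate_succ_apply', Function.iterate_succ_apply']
      set d := T^[j] c
      set d' := T^[j] c'
      have hsub : T d t - T d' t = ∫ s in (0 : ℝ)..t, (G s (ext d s) - G s (ext d' s)) := by
        rw [intervalIntegral.integral_sub
          (intervalIntegrable_of_integrable (hint _ (hext d)) h01 t.2)
          (intervalIntegrable_of_integrable (hint _ (hext d')) h01 t.2)]
        simp [T]
      have hle : ∀ᵐ s ∂unitVolume, ‖G s (ext d s) - G s (ext d' s)‖ ≤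
          dist c c' / 2 ^ j * (m s * Real.exp (2 * M s)) := by
        filter_upwards [hlip, ae_restrict_mem measurableSet_Icc] with s hs hs'
        refine (hs _ _).trans ?_
        have h1 := ih ⟨s, hs'⟩
        have h2 : ext d s = d ⟨s, hs'⟩ := IccExtend_of_mem _ _ hs'
        have h3 : ext d' s = d' ⟨s, hs'⟩ := IccExtend_of_mem _ _ hs'
        rw [h2, h3]
        have := mul_le_mul_of_nonneg_left h1 (hm0 s)
        dsimp only at this
        linarith
      rw [hsub]
      have h2 := integral_mul_exp_primitive_le hm hm0 two_ne_zero h01 t.2 t.2.1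
      rw [intervalIntegral.integral_same, mul_zero, Real.exp_zero] at h2
      refine (norm_intervalIntegral_le
        ((integrable_mul_of_continuousOn hm hwc).const_mul _) hle h01 t.2 t.2.1).trans ?_
      rw [intervalIntegral.integral_const_mul]
      have h3 : (0 : ℝ) ≤ dist c c' / 2 ^ j := by positivity
      calc _ ≤ dist c c' / 2 ^ j * (Real.exp (2 * M t) / 2) := by gcongr; linarith
        _ = _ := by rw [pow_succ]; ring
  obtain ⟨j, hj⟩ := exists_pow_lt_of_lt_one
    (show 0 < (Real.exp (2 * M 1))⁻¹ / 2 by positivity) (show (1 / 2 : ℝ) < 1 by norm_num)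
  have hcontr : ContractingWith (1 / 2) T^[j] := by
    refine ⟨by norm_num, LipschitzWith.of_dist_le_mul fun c c' => ?_⟩
    refine (ContinuousMap.dist_le (by positivity)).2 fun t => ?_
    rw [dist_eq_norm]
    refine (hT j c c' t).trans ?_
    have h1 : Real.exp (2 * M t) ≤ Real.exp (2 * M 1) := by
      have := primitive_mono hm hm0 t.2 h11 t.2.2
      gcongr
    have h2 : (1 / 2 : ℝ) ^ j * Real.exp (2 * M t) ≤ 1 / 2 := by
      calc _ ≤ (Real.exp (2 * M 1))⁻¹ / 2 * Real.exp (2 * M 1) := by gcongr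
        _ = _ := by field_simp
    calc _ = ((1 / 2 : ℝ) ^ j * Real.exp (2 * M t)) * dist c c' := by
          rw [one_div, inv_pow]; ring
      _ ≤ _ := by
          push_cast
          gcongr
  -- The unique fixed point of the contracting iterate is also fixed by `T`, because the two
  -- commute.
  have hfix := hcontr.isFixedPt_fixedPoint_iterate
  set c := ContractingWith.fixedPoint T^[j] hcontr
  refine ⟨ext c, hext c, fun t ht => ?_⟩
  have h1 : T c ⟨t, ht⟩ = c ⟨t, ht⟩ := by rw [hfix]
  have h2 : ext c t = c ⟨t, ht⟩ := IccExtend_of_mem _ _ ht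
  rw [h2, ← h1]
  rfl

end Gronwall

set_option maxSynthPendingDepth 3

/-! ### Linear equations with parameters. -/

section LinearEquation

variable {E : Type} [NormedAddCommGroup E] [NormedSpace ℝ E]
  {F G H : Type} [NormedAddCommGroup F] [NormedSpace ℝ F] [NormedAddCommGroup G] [NormedSpace ℝ G]
  [NormedAddCommGroup H] [NormedSpace ℝ H]
  {k : ℕ} {γ R C : ℝ} {m q ρ : ℝ → ℝ}

/-- The constant in Gronwall's inequality for a kernel of mass at most `R`. -/
noncomputable def gronwallConst (R : ℝ) : ℝ := 2 * Real.exp (2 * R)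

theorem gronwallConst_nonneg (R : ℝ) : 0 ≤ gronwallConst R := by
  unfold gronwallConst; positivity

/-- The form in which Gronwall is applied below: `y` is a solution, an increment of one, or its
first order Taylor remainder, and `ρ` bounds the inhomogeneity. -/
theorem norm_le_of_integral_eq {y w : ℝ → F} (hm : Integrable m unitVolume) (hm0 : ∀ s, 0 ≤ m s)
    (hR : ∫ s, m s ∂unitVolume ≤ R) (hρ : Integrable ρ unitVolume) (hρ0 : ∀ s, 0 ≤ ρ s)
    (hy : Continuous y) (heq : ∀ t ∈ Icc (0 : ℝ) 1, y t = ∫ s in (0 : ℝ)..t, w s)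
    (hw : ∀ᵐ s ∂unitVolume, ‖w s‖ ≤ m s * ‖y s‖ + ρ s) :
    ∀ t ∈ Icc (0 : ℝ) 1, ‖y t‖ ≤ gronwallConst R * ∫ s, ρ s ∂unitVolume := by
  have h01 : (0 : ℝ) ∈ Icc (0 : ℝ) 1 := by simp
  have hmy := integrable_mul_of_continuousOn hm hy.norm.continuousOn
  refine gronwall hm hm0 hR hy.norm.continuousOn (integral_nonneg hρ0) fun t ht => ?_
  rw [heq t ht]
  refine (norm_intervalIntegral_le (hmy.add hρ) hw h01 ht ht.1).trans ?_
  have := intervalIntegral_le_integral hρ hρ0 h01 ht ht.1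
  have h2 := intervalIntegral.integral_add (intervalIntegrable_of_integrable hmy h01 ht)
    (intervalIntegrable_of_integrable hρ h01 ht)
  simp only [Pi.add_apply]
  linarith

/-- Dominated convergence turns the little-o property at almost every time into one for the
integral; `D` is the dominating function of the quotients. -/
theorem hasFDerivAt_of_norm_le_integral {f : E → F} {f' : E →L[ℝ] F} {x : E} {κ : ℝ}
    {ρ : E → ℝ → ℝ} {D : ℝ → ℝ} (hD : Integrable D unitVolume) (hD0 : ∀ s, 0 ≤ D s)
    (hmeas : ∀ x', AEStronglyMeasurable (ρ x') unitVolume) (hρ0 : ∀ x' s, 0 ≤ ρ x' s)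
    (hρ : ∀ᵐ s ∂unitVolume, ∀ x', ρ x' s ≤ D s * ‖x' - x‖)
    (hlim : ∀ᵐ s ∂unitVolume, (fun x' => ρ x' s) =o[𝓝 x] fun x' => x' - x)
    (h : ∀ x', ‖f x' - f x - f' (x' - x)‖ ≤ κ * ∫ s, ρ x' s ∂unitVolume) :
    HasFDerivAt f f' x := by
  rw [hasFDerivAt_iff_tendsto]
  have hlim' : Tendsto (fun x' => ∫ s, ‖x' - x‖⁻¹ * ρ x' s ∂unitVolume) (𝓝 x)
      (𝓝 (∫ _s, (0 : ℝ) ∂unitVolume)) := by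
    refine tendsto_integral_filter_of_dominated_convergence D
      (Eventually.of_forall fun x' => (hmeas x').const_mul _) (Eventually.of_forall fun x' => ?_)
      hD ?_
    · filter_upwards [hρ] with s hs
      rw [Real.norm_of_nonneg (mul_nonneg (inv_nonneg.2 (norm_nonneg _)) (hρ0 _ _))]
      rcases eq_or_ne ‖x' - x‖ 0 with h0 | h0
      · rw [h0, inv_zero, zero_mul]
        exact hD0 s
      · rw [inv_mul_le_iff₀ (lt_of_le_of_ne (norm_nonneg _) h0.symm), mul_comm]
        exact hs x'
    · filter_upwards [hlim] with s hs
      have := hs.norm_right.tendsto_div_nhds_zero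
      simpa [div_eq_inv_mul] using this
  rw [integral_zero] at hlim'
  refine squeeze_zero (fun x' => by positivity) (fun x' => ?_)
    (by simpa using hlim'.const_mul κ)
  rw [integral_const_mul]
  calc _ ≤ ‖x' - x‖⁻¹ * (κ * ∫ s, ρ x' s ∂unitVolume) := by gcongr; exact h x'
    _ = _ := by ring

theorem tendsto_zero_of_norm_le_integral {f : E → F} {κ : ℝ} {b : ℝ → E → G}
    (hq : Integrable q unitVolume) (hmeas : ∀ x, AEStronglyMeasurable (fun s => b s x) unitVolume)
    (hb : ∀ᵐ s ∂unitVolume, ∀ x, ‖b s x‖ ≤ q s)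
    (hlim : ∀ᵐ s ∂unitVolume, Tendsto (b s) (Bornology.cobounded E) (𝓝 0))
    (h : ∀ x, ‖f x‖ ≤ κ * ∫ s, ‖b s x‖ ∂unitVolume) :
    Tendsto f (Bornology.cobounded E) (𝓝 0) := by
  have : (Bornology.cobounded E).IsCountablyGenerated := by
    rw [← comap_norm_atTop]
    infer_instance
  have hlim' : Tendsto (fun x => ∫ s, ‖b s x‖ ∂unitVolume) (Bornology.cobounded E)
      (𝓝 (∫ _s, (0 : ℝ) ∂unitVolume)) := by
    refine tendsto_integral_filter_of_dominated_convergence q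
      (Eventually.of_forall fun x => (hmeas x).norm) (Eventually.of_forall fun x => ?_) hq ?_
    · filter_upwards [hb] with s hs
      simpa using hs x
    · filter_upwards [hlim] with s hs
      simpa using hs.norm
  rw [integral_zero] at hlim'
  exact squeeze_zero_norm h (by simpa using hlim'.const_mul κ)

theorem integrable_clm_apply {A : ℝ → F →L[ℝ] G} {c : ℝ → F} (hm : Integrable m unitVolume)
    (hA : AEStronglyMeasurable A unitVolume) (hAm : ∀ᵐ s ∂unitVolume, ‖A s‖ ≤ m s)
    (hc : Continuous c) : Integrable (fun s => A s (c s)) unitVolume := by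
  refine (integrable_mul_of_continuousOn hm hc.norm.continuousOn).mono'
    ((ContinuousLinearMap.id ℝ (F →L[ℝ] G)).aestronglyMeasurable_comp₂ hA
      hc.aestronglyMeasurable) ?_
  filter_upwards [hAm] with s hs
  exact ((A s).le_opNorm _).trans (by gcongr)

/-- Directional derivatives are limits of measurable difference quotients, and in finite dimension
the derivative is recovered from those along a basis. -/
theorem aestronglyMeasurable_fderiv [FiniteDimensional ℝ E] {A : ℝ → E → F}
    (hA : ∀ x, AEStronglyMeasurable (fun s => A s x) unitVolume)
    (hd : ∀ᵐ s ∂unitVolume, Differentiable ℝ (A s)) (x : E) :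
    AEStronglyMeasurable (fun s => fderiv ℝ (A s) x) unitVolume := by
  have h1 : ∀ v, AEStronglyMeasurable (fun s => fderiv ℝ (A s) x v) unitVolume := fun v => by
    refine aestronglyMeasurable_of_tendsto_ae atTop
      (f := fun (n : ℕ) s => (n : ℝ) • (A s (x + (n : ℝ)⁻¹ • v) - A s x))
      (fun n => ((hA _).sub (hA x)).const_smul _) ?_
    filter_upwards [hd] with s hs
    exact (hs x).hasFDerivAt.lim v
      (tendsto_norm_atTop_atTop.comp tendsto_natCast_atTop_atTop)
  let e := Module.finBasis ℝ E
  have h2 : (fun s => fderiv ℝ (A s) x) = fun s => ∑ i, ContinuousLinearMap.smulRightL ℝ E F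
      (LinearMap.toContinuousLinearMap (e.coord i)) (fderiv ℝ (A s) x (e i)) := by
    funext s
    refine ContinuousLinearMap.coe_injective (e.ext fun j => ?_)
    simp [Finsupp.single_apply, Finset.sum_ite_eq]
  rw [h2]
  exact Finset.aestronglyMeasurable_fun_sum _ fun i _ =>
    (ContinuousLinearMap.continuous _).comp_aestronglyMeasurable (h1 _)

/-- A time dependent function which, at almost every time `s`, satisfies `CkBound k γ (m s)`. -/
structure TimeCkBound (k : ℕ) (γ : ℝ) (m : ℝ → ℝ) (A : ℝ → E → F) : Prop where
  meas : ∀ x, AEStronglyMeasurable (fun s => A s x) unitVolume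
  ae : ∀ᵐ s ∂unitVolume, CkBound k γ (m s) (A s)

namespace TimeCkBound

variable {A : ℝ → E → F}

theorem of_succ (h : TimeCkBound (k + 1) γ m A) : TimeCkBound k γ m A :=
  ⟨h.meas, h.ae.mono fun _ hs => hs.of_succ⟩

theorem fderiv [FiniteDimensional ℝ E] (h : TimeCkBound (k + 1) γ m A) :
    TimeCkBound k γ m (fun s => _root_.fderiv ℝ (A s)) :=
  ⟨aestronglyMeasurable_fderiv h.meas (h.ae.mono fun _ hs => hs.2.1), h.ae.mono fun _ hs => hs.2.2⟩

theorem add {B : ℝ → E → F} (hA : TimeCkBound k γ m A) (hB : TimeCkBound k γ q B) :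
    TimeCkBound k γ (fun s => m s + q s) (fun s x => A s x + B s x) where
  meas x := (hA.meas x).add (hB.meas x)
  ae := by
    filter_upwards [hA.ae, hB.ae] with s h1 h2 using h1.add h2

theorem clm_comp (hA : TimeCkBound k γ m A) (L : F →L[ℝ] G) (hL : ‖L‖ ≤ 1) :
    TimeCkBound k γ m (fun s x => L (A s x)) where
  meas x := L.continuous.comp_aestronglyMeasurable (hA.meas x)
  ae := hA.ae.mono fun _ hs => hs.clm_comp L hL

theorem bilinear (hA : TimeCkBound k γ m A) {f : ℝ → E → G} (hc : ∀ x, Continuous fun s => f s x)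
    (hf : ∀ s ∈ Icc (0 : ℝ) 1, CkBound k γ C (f s)) (L : F →L[ℝ] G →L[ℝ] H) (hL : ‖L‖ ≤ 1) :
    TimeCkBound k γ (fun s => 2 ^ (k + 1) * (m s * C)) (fun s x => L (A s x) (f s x)) where
  meas x := L.aestronglyMeasurable_comp₂ (hA.meas x) (hc x).aestronglyMeasurable
  ae := by
    filter_upwards [hA.ae, ae_restrict_mem measurableSet_Icc] with s h1 h2
      using h1.bilinear (hf s h2) L hL

theorem norm_le (hA : TimeCkBound k γ m A) : ∀ᵐ s ∂unitVolume, ∀ x, ‖A s x‖ ≤ m s :=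
  hA.ae.mono fun _ hs => hs.holderBound.bound

theorem integrable (hA : TimeCkBound k γ m A) (hm : Integrable m unitVolume) (x : E) :
    Integrable (fun s => A s x) unitVolume :=
  hm.mono' (hA.meas x) (hA.norm_le.mono fun _ hs => hs x)

end TimeCkBound

/-- `f` solves the linear equation `∂ₜ f = A f + b` with `f(0) = 0`. -/
structure SolvesLinear (A : ℝ → E → F →L[ℝ] F) (b f : ℝ → E → F) : Prop where
  cont : ∀ x, Continuous fun t => f t x
  eq : ∀ x, ∀ t ∈ Icc (0 : ℝ) 1, f t x = ∫ s in (0 : ℝ)..t, (A s x (f s x) + b s x)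

variable {A : ℝ → E → F →L[ℝ] F} {b f : ℝ → E → F}

theorem exists_solvesLinear [CompleteSpace F] (hm : Integrable m unitVolume) (hm0 : ∀ s, 0 ≤ m s)
    (hq : Integrable q unitVolume) (hA : TimeCkBound k γ m A) (hb : TimeCkBound k γ q b) :
    ∃ f, SolvesLinear A b f := by
  have key : ∀ x, ∃ c : ℝ → F, Continuous c ∧
      ∀ t ∈ Icc (0 : ℝ) 1, c t = 0 + ∫ s in (0 : ℝ)..t, (A s x (c s) + b s x) := fun x => by
    refine exists_integral_solution (G := fun s y => A s x y + b s x) 0 hm hm0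
      (fun c hc => (integrable_clm_apply hm (hA.meas x) (hA.norm_le.mono fun _ hs => hs x) hc).add
        (hb.integrable hq x)) ?_
    filter_upwards [hA.norm_le] with s hs y z
    rw [add_sub_add_right_eq_sub, ← map_sub]
    exact (A s x).le_of_opNorm_le (hs x) _
  choose c hc hceq using key
  exact ⟨fun t x => c x t, hc, fun x t ht => by simpa using hceq x t ht⟩

theorem SolvesLinear.integrable (hf : SolvesLinear A b f) (hm : Integrable m unitVolume)
    (hq : Integrable q unitVolume) (hA : TimeCkBound k γ m A) (hb : TimeCkBound k γ q b) (x : E) :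
    Integrable (fun s => A s x (f s x) + b s x) unitVolume :=
  (integrable_clm_apply hm (hA.meas x) (hA.norm_le.mono fun _ hs => hs x) (hf.cont x)).add
    (hb.integrable hq x)

theorem SolvesLinear.norm_le (hf : SolvesLinear A b f) (hm : Integrable m unitVolume)
    (hm0 : ∀ s, 0 ≤ m s) (hR : ∫ s, m s ∂unitVolume ≤ R) (hq : Integrable q unitVolume)
    (hA : TimeCkBound k γ m A) (hb : TimeCkBound k γ q b) {t : ℝ} (ht : t ∈ Icc (0 : ℝ) 1) (x : E) :
    ‖f t x‖ ≤ gronwallConst R * ∫ s, ‖b s x‖ ∂unitVolume := by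
  refine norm_le_of_integral_eq hm hm0 hR (hb.integrable hq x).norm (fun _ => norm_nonneg _)
    (hf.cont x) (hf.eq x) ?_ t ht
  filter_upwards [hA.norm_le] with s hs
  exact (norm_add_le _ _).trans (add_le_add_left ((A s x).le_of_opNorm_le (hs x) _) _)

theorem SolvesLinear.norm_le' (hf : SolvesLinear A b f) (hm : Integrable m unitVolume)
    (hm0 : ∀ s, 0 ≤ m s) (hR : ∫ s, m s ∂unitVolume ≤ R) (hq : Integrable q unitVolume)
    (hA : TimeCkBound k γ m A) (hb : TimeCkBound k γ q b) {t : ℝ} (ht : t ∈ Icc (0 : ℝ) 1) (x : E) :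
    ‖f t x‖ ≤ gronwallConst R * ∫ s, q s ∂unitVolume := by
  refine (hf.norm_le hm hm0 hR hq hA hb ht x).trans ?_
  exact mul_le_mul_of_nonneg_left (integral_mono_ae (hb.integrable hq x).norm hq
    (hb.norm_le.mono fun _ hs => hs x)) (gronwallConst_nonneg R)

/-- The increment of `f` between `x` and `y` solves the equation with coefficient `A s x` and
inhomogeneity `(A s x - A s y) (f s y) + (b s x - b s y)`, which is of order `‖x - y‖ ^ γ`; Gronwall
then applies. Decay comes from the pointwise bound by `b` and dominated convergence. -/
theorem SolvesLinear.holderBound (hf : SolvesLinear A b f) (hm : Integrable m unitVolume)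
    (hm0 : ∀ s, 0 ≤ m s) (hR : ∫ s, m s ∂unitVolume ≤ R) (hq : Integrable q unitVolume)
    (hq0 : ∀ s, 0 ≤ q s) (hA : TimeCkBound k γ m A) (hb : TimeCkBound k γ q b)
    {t : ℝ} (ht : t ∈ Icc (0 : ℝ) 1) :
    HolderBound γ (gronwallConst R * (1 + R * gronwallConst R) * ∫ s, q s ∂unitVolume) (f t) := by
  have hκ := gronwallConst_nonneg R
  have hR0 : 0 ≤ R := (integral_nonneg hm0).trans hR
  have hQ : 0 ≤ ∫ s, q s ∂unitVolume := integral_nonneg hq0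
  set Q := ∫ s, q s ∂unitVolume
  have hbd : ∀ t ∈ Icc (0 : ℝ) 1, ∀ x, ‖f t x‖ ≤ gronwallConst R * Q := fun t ht x =>
    hf.norm_le' hm hm0 hR hq hA hb ht x
  refine ⟨fun x => (hbd t ht x).trans ?_, fun x y => ?_, ?_⟩
  · have : 0 ≤ gronwallConst R * (R * gronwallConst R) * Q := by positivity
    linarith
  · have h1 := norm_le_of_integral_eq (y := fun t => f t x - f t y)
      (w := fun s => (A s x (f s x) + b s x) - (A s y (f s y) + b s y))
      (ρ := fun s => (m s * (gronwallConst R * Q) + q s) * ‖x - y‖ ^ γ) hm hm0 hR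
      (((hm.mul_const _).add hq).mul_const _)
      (fun s => by have := hm0 s; have := hq0 s; positivity)
      ((hf.cont x).sub (hf.cont y)) (fun t ht => by
        rw [intervalIntegral.integral_sub
          (intervalIntegrable_of_integrable (hf.integrable hm hq hA hb x) (by simp) ht)
          (intervalIntegrable_of_integrable (hf.integrable hm hq hA hb y) (by simp) ht),
          hf.eq x t ht, hf.eq y t ht]) ?_ t ht
    · refine h1.trans ?_
      rw [integral_mul_const, integral_add (hm.mul_const _) hq, integral_mul_const]
      calc _ ≤ gronwallConst R * ((R * (gronwallConst R * Q) + Q) * ‖x - y‖ ^ γ) := by gcongr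
        _ = _ := by ring
    · filter_upwards [hA.ae, hb.ae, ae_restrict_mem measurableSet_Icc] with s h1 h2 hs
      have h1 := h1.holderBound
      have e : (A s x (f s x) + b s x) - (A s y (f s y) + b s y) =
          A s x (f s x - f s y) + ((A s x - A s y) (f s y) + (b s x - b s y)) := by
        simp only [map_sub, _root_.sub_apply]
        abel
      rw [e]
      refine (norm_add_le _ _).trans (add_le_add ((A s x).le_of_opNorm_le (h1.bound x) _)
        ((norm_add_le _ _).trans ?_))
      have h3 := (A s x - A s y).le_of_opNorm_le (h1.holder x y) (f s y)
      have h4 := h2.holderBound.holder x y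
      have h5 : m s * ‖x - y‖ ^ γ * ‖f s y‖ ≤ m s * ‖x - y‖ ^ γ * (gronwallConst R * Q) := by
        have := hm0 s
        gcongr
        exact hbd s hs y
      linarith
  · exact tendsto_zero_of_norm_le_integral hq hb.meas hb.norm_le
      (hb.ae.mono fun s hs => hs.holderBound.decay)
      (fun x => hf.norm_le hm hm0 hR hq hA hb ht x)

theorem CkBound.norm_sub_le {f : E → F} (hf : CkBound (k + 1) γ C f) (x y : E) :
    ‖f x - f y‖ ≤ C * ‖x - y‖ :=
  convex_univ.norm_image_sub_le_of_norm_fderiv_le (fun z _ => hf.2.1 z)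
    (fun z _ => hf.2.2.holderBound.bound z) (mem_univ y) (mem_univ x)

theorem CkBound.norm_taylor_le {f : E → F} (hf : CkBound (k + 1) γ C f) (x y : E) :
    ‖f y - f x - fderiv ℝ f x (y - x)‖ ≤ 2 * C * ‖y - x‖ := by
  refine (_root_.norm_sub_le _ _).trans ?_
  have := (fderiv ℝ f x).le_of_opNorm_le (hf.2.2.holderBound.bound x) (y - x)
  linarith [hf.norm_sub_le y x]

/-- The candidate `g` solves the formally differentiated equation. The Taylor remainder of `f` then
solves a linear equation with coefficient `A s x'`, whose inhomogeneity consists of Taylor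
remainders of `A` and `b` and the second order term `(A s x' - A s x) (g s x (x' - x))`. -/
theorem SolvesLinear.hasFDerivAt [FiniteDimensional ℝ E] {g : ℝ → E → E →L[ℝ] F}
    (hf : SolvesLinear A b f)
    (hm : Integrable m unitVolume) (hm0 : ∀ s, 0 ≤ m s) (hq : Integrable q unitVolume)
    (hq0 : ∀ s, 0 ≤ q s) (hA : TimeCkBound (k + 1) γ m A) (hb : TimeCkBound (k + 1) γ q b)
    {C : ℝ} (hfC : ∀ s ∈ Icc (0 : ℝ) 1, ∀ x, ‖f s x‖ ≤ C)
    (hgC : ∀ s ∈ Icc (0 : ℝ) 1, ∀ x, ‖g s x‖ ≤ C)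
    (hgc : ∀ x, Continuous fun s => g s x)
    (hg : ∀ x, ∀ t ∈ Icc (0 : ℝ) 1, g t x = ∫ s in (0 : ℝ)..t,
      ((A s x).comp (g s x) + ((fderiv ℝ (A s) x).flip (f s x) + fderiv ℝ (b s) x)))
    (hgi : ∀ x, Integrable (fun s =>
      (A s x).comp (g s x) + ((fderiv ℝ (A s) x).flip (f s x) + fderiv ℝ (b s) x)) unitVolume)
    {t : ℝ} (ht : t ∈ Icc (0 : ℝ) 1) (x : E) : HasFDerivAt (f t) (g t x) x := by
  have hC : 0 ≤ C := (norm_nonneg _).trans (hfC 0 (by simp) 0)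
  have hdA := hA.fderiv
  have hdb := hb.fderiv
  set ρ : E → ℝ → ℝ := fun x' s => ‖A s x' - A s x - fderiv ℝ (A s) x (x' - x)‖ * C +
    ‖A s x' - A s x‖ * (C * ‖x' - x‖) + ‖b s x' - b s x - fderiv ℝ (b s) x (x' - x)‖ with hρ
  have hρm : ∀ x', AEStronglyMeasurable (ρ x') unitVolume := fun x' =>
    ((((((hA.meas x').sub (hA.meas x)).sub
      ((hdA.meas x).apply_continuousLinearMap (x' - x))).norm.mul_const _).add
      (((hA.meas x').sub (hA.meas x)).norm.mul_const _)).add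
      (((hb.meas x').sub (hb.meas x)).sub
        ((hdb.meas x).apply_continuousLinearMap (x' - x))).norm)
  have hρ0 : ∀ x' s, 0 ≤ ρ x' s := fun x' s => by positivity
  have hρD : ∀ᵐ s ∂unitVolume, ∀ x', ρ x' s ≤ (4 * C * m s + 2 * q s) * ‖x' - x‖ := by
    filter_upwards [hA.ae, hb.ae] with s h1 h2 x'
    have e1 := mul_le_mul_of_nonneg_right (h1.norm_taylor_le x x') hC
    have e2 := h2.norm_taylor_le x x'
    have e3 : ‖A s x' - A s x‖ ≤ 2 * m s := (_root_.norm_sub_le _ _).trans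
      (by linarith [h1.holderBound.bound x', h1.holderBound.bound x])
    have e4 := mul_le_mul_of_nonneg_right e3 (mul_nonneg hC (norm_nonneg (x' - x)))
    simp only [hρ]
    linarith
  have hDi : Integrable (fun s => 4 * C * m s + 2 * q s) unitVolume :=
    (hm.const_mul _).add (hq.const_mul _)
  have hρi : ∀ x', Integrable (ρ x') unitVolume := fun x' =>
    (hDi.mul_const ‖x' - x‖).mono' (hρm x') (hρD.mono fun s hs => by
      rw [Real.norm_of_nonneg (hρ0 x' s)]
      exact hs x')
  refine hasFDerivAt_of_norm_le_integral (κ := gronwallConst (∫ s, m s ∂unitVolume)) hDi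
    (fun s => by have := hm0 s; have := hq0 s; positivity) hρm hρ0 hρD ?_ fun x' => ?_
  · filter_upwards [hA.ae, hb.ae] with s h1 h2
    have e1 := (hasFDerivAt_iff_isLittleO.1 (h1.2.1 x).hasFDerivAt).norm_left.const_mul_left C
    have e2 := (hasFDerivAt_iff_isLittleO.1 (h2.2.1 x).hasFDerivAt).norm_left
    have e3 : (fun x' => ‖A s x' - A s x‖ * (C * ‖x' - x‖)) =o[𝓝 x] fun x' => x' - x := by
      have e4 : Tendsto (fun x' => ‖A s x' - A s x‖ * C) (𝓝 x) (𝓝 0) := by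
        have := (h1.2.1 x).continuousAt.sub_const (A s x) |>.norm.mul_const C
        simpa [ContinuousAt] using this
      have e5 := ((Asymptotics.isLittleO_one_iff ℝ).2 e4).mul_isBigO
        (Asymptotics.isBigO_refl (fun x' => ‖x' - x‖) (𝓝 x))
      simp only [one_mul, mul_assoc] at e5
      exact e5.of_norm_right
    refine ((e1.congr_left fun x' => ?_).add e3).add e2
    ring
  · refine norm_le_of_integral_eq (y := fun t => f t x' - f t x - g t x (x' - x))
      (w := fun s => (A s x' (f s x') + b s x') - (A s x (f s x) + b s x) -
        ((A s x).comp (g s x) + ((fderiv ℝ (A s) x).flip (f s x) + fderiv ℝ (b s) x)) (x' - x))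
      hm hm0 le_rfl (hρi x') (hρ0 x')
      (((hf.cont x').sub (hf.cont x)).sub ((hgc x).clm_apply continuous_const))
      (fun t ht => ?_) ?_ t ht
    · have i1 := intervalIntegrable_of_integrable (hf.integrable hm hq hA hb x') (a := 0)
        (by simp) ht
      have i2 := intervalIntegrable_of_integrable (hf.integrable hm hq hA hb x) (a := 0)
        (by simp) ht
      have i3 := intervalIntegrable_of_integrable (hgi x) (a := 0) (by simp) ht
      rw [intervalIntegral.integral_sub (i1.sub i2)
        (intervalIntegrable_of_integrable ((hgi x).apply_continuousLinearMap _) (by simp) ht),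
        intervalIntegral.integral_sub i1 i2,
        ← ContinuousLinearMap.intervalIntegral_apply i3, hf.eq x' t ht, hf.eq x t ht, hg x t ht]
    · filter_upwards [hA.ae, hb.ae, ae_restrict_mem measurableSet_Icc] with s h1 h2 hs
      have e : (A s x' (f s x') + b s x') - (A s x (f s x) + b s x) -
          ((A s x).comp (g s x) + ((fderiv ℝ (A s) x).flip (f s x) + fderiv ℝ (b s) x)) (x' - x) =
          A s x' (f s x' - f s x - g s x (x' - x)) +
          ((A s x' - A s x - fderiv ℝ (A s) x (x' - x)) (f s x) +
          (A s x' - A s x) (g s x (x' - x)) + (b s x' - b s x - fderiv ℝ (b s) x (x' - x))) := by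
        simp only [map_sub, _root_.sub_apply, _root_.add_apply, ContinuousLinearMap.comp_apply,
          ContinuousLinearMap.flip_apply]
        abel
      rw [e]
      refine (norm_add_le _ _).trans (add_le_add
        ((A s x').le_of_opNorm_le (h1.holderBound.bound x') _) ?_)
      refine (norm_add_le _ _).trans (add_le_add_left ((norm_add_le _ _).trans (add_le_add
        ?_ ?_)) _)
      · exact (ContinuousLinearMap.le_opNorm _ _).trans (by gcongr; exact hfC s hs x)
      · refine (ContinuousLinearMap.le_opNorm _ _).trans ?_
        gcongr
        exact (g s x).le_of_opNorm_le (hgC s hs x) _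

/-- Solutions of linear equations with parameters are as regular as the coefficients, with bounds that
are linear in the inhomogeneity. -/
theorem SolvesLinear.ckBound [FiniteDimensional ℝ E] (k : ℕ) {R : ℝ} (hR0 : 0 ≤ R) (γ : ℝ) :
    ∃ c : ℝ, 0 ≤ c ∧ ∀ {F : Type} [NormedAddCommGroup F] [NormedSpace ℝ F] [CompleteSpace F]
      {A : ℝ → E → F →L[ℝ] F} {b f : ℝ → E → F} {m q : ℝ → ℝ}, SolvesLinear A b f →
      Integrable m unitVolume → (∀ s, 0 ≤ m s) → ∫ s, m s ∂unitVolume ≤ R →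
      Integrable q unitVolume → (∀ s, 0 ≤ q s) → TimeCkBound k γ m A → TimeCkBound k γ q b →
      ∀ t ∈ Icc (0 : ℝ) 1, CkBound k γ (c * ∫ s, q s ∂unitVolume) (f t) := by
  have hκ := gronwallConst_nonneg R
  induction k with
  | zero =>
    exact ⟨gronwallConst R * (1 + R * gronwallConst R), by positivity,
      fun hf hm hm0 hR hq hq0 hA hb t ht => hf.holderBound hm hm0 hR hq hq0 hA hb ht⟩
  | succ k ih =>
    obtain ⟨c, hc, ih⟩ := ih
    refine ⟨gronwallConst R * (1 + R * gronwallConst R) + c * (1 + 2 ^ (k + 1) * (R * c)),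
      by positivity, fun {F _ _ _ A b f m q} hf hm hm0 hR hq hq0 hA hb t ht => ?_⟩
    have hQ : 0 ≤ ∫ s, q s ∂unitVolume := integral_nonneg hq0
    set Q := ∫ s, q s ∂unitVolume with hQdef
    have hfk := ih hf hm hm0 hR hq hq0 hA.of_succ hb.of_succ
    -- The derivative of `f` solves an equation of the same type with values in `E →L[ℝ] F`, which
    -- is why the induction quantifies over `F`. Its inhomogeneity `b'` contains `f`, already
    -- controlled to order `k`.
    let A' : ℝ → E → (E →L[ℝ] F) →L[ℝ] (E →L[ℝ] F) := fun s x =>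
      ContinuousLinearMap.compL ℝ E F F (A s x)
    let fl := ((ContinuousLinearMap.flipₗᵢ ℝ E F F).toLinearIsometry).toContinuousLinearMap
    have hfl : ‖fl‖ ≤ 1 := LinearIsometry.norm_toContinuousLinearMap_le _
    let b' : ℝ → E → E →L[ℝ] F := fun s x => fl (fderiv ℝ (A s) x) (f s x) + fderiv ℝ (b s) x
    let q' : ℝ → ℝ := fun s => 2 ^ (k + 1) * (m s * (c * Q)) + q s
    have hA' : TimeCkBound k γ m A' :=
      hA.of_succ.clm_comp _ (ContinuousLinearMap.norm_compL_le ℝ E F F)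
    have hb' : TimeCkBound k γ q' b' := (hA.fderiv.bilinear hf.cont hfk fl hfl).add hb.fderiv
    have hq' : Integrable q' unitVolume := ((hm.mul_const _).const_mul _).add hq
    have hq'0 : ∀ s, 0 ≤ q' s := fun s => by
      have := hm0 s
      have := hq0 s
      positivity
    obtain ⟨g, hg⟩ := exists_solvesLinear hm hm0 hq' hA' hb'
    have hgk := ih hg hm hm0 hR hq' hq'0 hA' hb'
    have hq'Q : ∫ s, q' s ∂unitVolume ≤ (1 + 2 ^ (k + 1) * (R * c)) * Q := by
      rw [integral_add ((hm.mul_const _).const_mul _) hq, integral_const_mul, integral_mul_const]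
      have : (∫ s, m s ∂unitVolume) * (c * Q) ≤ R * (c * Q) := by gcongr
      have := mul_le_mul_of_nonneg_left this (show (0 : ℝ) ≤ 2 ^ (k + 1) by positivity)
      linarith
    have hder : ∀ x, HasFDerivAt (f t) (g t x) x := fun x =>
      hf.hasFDerivAt hm hm0 hq hq0 hA hb (C := c * Q + c * ∫ s, q' s ∂unitVolume)
        (fun s hs x => ((hfk s hs).holderBound.bound x).trans
          (le_add_of_nonneg_right (mul_nonneg hc (integral_nonneg hq'0))))
        (fun s hs x => ((hgk s hs).holderBound.bound x).trans
          (le_add_of_nonneg_left (mul_nonneg hc hQ))) hg.cont hg.eq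
        (fun x => hg.integrable hm hq' hA' hb' x) ht x
    refine ⟨(hf.holderBound hm hm0 hR hq hq0 hA hb ht).mono ?_,
      fun x => (hder x).differentiableAt, ?_⟩
    · gcongr
      exact le_add_of_nonneg_right (by positivity)
    · rw [show fderiv ℝ (f t) = g t from funext fun x => (hder x).fderiv]
      refine (hgk t ht).mono ?_
      have h1 := mul_le_mul_of_nonneg_left hq'Q hc
      have h2 : 0 ≤ gronwallConst R * (1 + R * gronwallConst R) * Q := by positivity
      linarith

end LinearEquation

/-! ### Flows: dependence on the starting point and on the field. -/

section FlowEquation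

variable {E : Type} [NormedAddCommGroup E] [NormedSpace ℝ E]
  {F : Type} [NormedAddCommGroup F] [NormedSpace ℝ F]
  {k n : ℕ} {γ R C K : ℝ} {m q : ℝ → ℝ}

/-- A time dependent function which, at almost every time `s`, satisfies `CkBound k γ (m s)`, and
which is measurable along continuous curves. -/
structure FieldCkBound (k : ℕ) (γ : ℝ) (m : ℝ → ℝ) (v : ℝ → E → F) : Prop where
  meas : ∀ c : ℝ → E, Continuous c → AEStronglyMeasurable (fun s => v s (c s)) unitVolume
  ae : ∀ᵐ s ∂unitVolume, CkBound k γ (m s) (v s)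

/-- A time dependent displacement `φ`, continuous in time, for which the mappings `id + φ(s)` are
uniformly Lipschitz and proper. -/
structure AdmissibleDisp (K : ℝ) (φ : ℝ → E → E) : Prop where
  cont : ∀ x, Continuous fun s => φ s x
  lip : ∀ s ∈ Icc (0 : ℝ) 1, ∀ x y, ‖(x + φ s x) - (y + φ s y)‖ ≤ K * ‖x - y‖
  tendsto : ∀ s ∈ Icc (0 : ℝ) 1,
    Tendsto (fun x => x + φ s x) (Bornology.cobounded E) (Bornology.cobounded E)

/-- `id + φ` is the flow of the time dependent vector field `v`. -/
structure IsFlowDisp (v φ : ℝ → E → E) : Prop where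
  cont : ∀ x, Continuous fun s => φ s x
  eq : ∀ x, ∀ t ∈ Icc (0 : ℝ) 1, φ t x = ∫ s in (0 : ℝ)..t, v s (x + φ s x)

theorem TimeCkBound.congr {A B : ℝ → E → F} (hA : TimeCkBound k γ m A)
    (h : ∀ᵐ s ∂unitVolume, A s = B s) : TimeCkBound k γ m B where
  meas x := (hA.meas x).congr (h.mono fun s hs => by simp only [hs])
  ae := by
    filter_upwards [hA.ae, h] with s h1 h2
    rwa [← h2]

namespace FieldCkBound

variable {v : ℝ → E → F}

theorem of_le {l : ℕ} (h : FieldCkBound k γ m v) (hl : l ≤ k) : FieldCkBound l γ m v :=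
  ⟨h.meas, h.ae.mono fun _ hs => hs.of_le hl⟩

theorem mono_exponent {γ' : ℝ} (h : FieldCkBound k γ m v) (h0 : 0 ≤ γ') (hγ : γ' ≤ γ) :
    FieldCkBound k γ' (fun s => 2 * m s) v :=
  ⟨h.meas, h.ae.mono fun _ hs => hs.mono_exponent h0 hγ⟩

theorem fderiv [FiniteDimensional ℝ E] (h : FieldCkBound (k + 1) γ m v) :
    FieldCkBound k γ m (fun s => _root_.fderiv ℝ (v s)) where
  meas c hc := by
    -- Translating by the curve reduces measurability along `c` to measurability at the fixed point
    -- `0`.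
    have := aestronglyMeasurable_fderiv (A := fun s x => v s (c s + x))
      (fun x => h.meas _ (hc.add continuous_const))
      (h.ae.mono fun s hs => hs.2.1.comp (differentiable_id.const_add (c s))) 0
    simpa [fderiv_comp_add_left] using this
  ae := h.ae.mono fun _ hs => hs.2.2

theorem integrable_comp (h : FieldCkBound k γ m v) (hm : Integrable m unitVolume) {c : ℝ → E}
    (hc : Continuous c) : Integrable (fun s => v s (c s)) unitVolume :=
  hm.mono' (h.meas c hc) (h.ae.mono fun _ hs => hs.holderBound.bound _)

theorem comp (k : ℕ) {γ : ℝ} (h0 : 0 ≤ γ) (h1 : γ ≤ 1) {K : ℝ} (hK : 1 ≤ K)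
    {C : ℝ} (hC : 0 ≤ C) :
    ∃ c : ℝ, 1 ≤ c ∧ ∀ {F : Type} [NormedAddCommGroup F] [NormedSpace ℝ F] {m : ℝ → ℝ}
      {v : ℝ → E → F} {φ : ℝ → E → E}, FieldCkBound k γ m v → AdmissibleDisp K φ →
      (∀ s ∈ Icc (0 : ℝ) 1, CkBound k γ C (φ s)) →
      TimeCkBound k γ (fun s => c * m s) (fun s x => v s (x + φ s x)) := by
  obtain ⟨c, hc, h⟩ := CkBound.comp (E := E) k h0 h1 hK hC
  refine ⟨c, hc, fun {F _ _ m v φ} hv hφ hφC =>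
    ⟨fun x => hv.meas _ (continuous_const.add (hφ.cont x)), ?_⟩⟩
  filter_upwards [hv.ae, ae_restrict_mem measurableSet_Icc] with s hs hs'
    using h hs (hφC s hs') (hφ.lip s hs') (hφ.tendsto s hs')

theorem comp_sub_comp (k : ℕ) {γ : ℝ} (h0 : 0 ≤ γ) {K : ℝ} (hK : 1 ≤ K)
    {C : ℝ} (hC : 0 ≤ C) :
    ∃ c : ℝ, 1 ≤ c ∧ ∀ {F : Type} [NormedAddCommGroup F] [NormedSpace ℝ F] {m : ℝ → ℝ} {δ : ℝ}
      {v : ℝ → E → F} {φ ψ : ℝ → E → E}, FieldCkBound k γ m v → AdmissibleDisp K φ →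
      AdmissibleDisp K ψ → (∀ s ∈ Icc (0 : ℝ) 1, CkBound k 0 C (φ s)) →
      (∀ s ∈ Icc (0 : ℝ) 1, CkBound k 0 C (ψ s)) →
      (∀ s ∈ Icc (0 : ℝ) 1, ∀ x, ‖φ s x - ψ s x‖ ^ γ ≤ δ) →
      (∀ s ∈ Icc (0 : ℝ) 1, CkBound k 0 δ (fun x => φ s x - ψ s x)) →
      TimeCkBound k 0 (fun s => c * (m s * δ))
        (fun s x => v s (x + φ s x) - v s (x + ψ s x)) := by
  obtain ⟨c, hc, h⟩ := CkBound.comp_sub_comp (E := E) k h0 hK hC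
  refine ⟨c, hc, fun {F _ _ m δ v φ ψ} hv hφ hψ hφC hψC hδ hφψ =>
    ⟨fun x => (hv.meas _ (continuous_const.add (hφ.cont x))).sub
      (hv.meas _ (continuous_const.add (hψ.cont x))), ?_⟩⟩
  filter_upwards [hv.ae, ae_restrict_mem measurableSet_Icc] with s hs hs'
    using h hs (hφC s hs') (hψC s hs') (hφ.lip s hs') (hψ.lip s hs') (hφ.tendsto s hs')
      (hψ.tendsto s hs') (hδ s hs') (hφψ s hs')

end FieldCkBound

variable {v φ : ℝ → E → E}

theorem exists_isFlowDisp [CompleteSpace E] (hm : Integrable m unitVolume) (hm0 : ∀ s, 0 ≤ m s)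
    (hv : FieldCkBound (k + 1) γ m v) : ∃ φ, IsFlowDisp v φ := by
  have key : ∀ x, ∃ c : ℝ → E, Continuous c ∧
      ∀ t ∈ Icc (0 : ℝ) 1, c t = 0 + ∫ s in (0 : ℝ)..t, v s (x + c s) := fun x => by
    refine exists_integral_solution (G := fun s y => v s (x + y)) 0 hm hm0
      (fun c hc => hv.integrable_comp hm (continuous_const.add hc)) ?_
    filter_upwards [hv.ae] with s hs y z
    simpa using hs.norm_sub_le (x + y) (x + z)
  choose c hc hceq using key
  exact ⟨fun t x => c x t, hc, fun x t ht => by simpa using hceq x t ht⟩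

/-- The constant in the Lipschitz bound for flows of fields of mass at most `R`. -/
noncomputable def flowLipConst (R : ℝ) : ℝ := 1 + gronwallConst R * R

theorem one_le_flowLipConst (hR : 0 ≤ R) : 1 ≤ flowLipConst R :=
  le_add_of_nonneg_right (mul_nonneg (gronwallConst_nonneg R) hR)

namespace IsFlowDisp

theorem integrable (hφ : IsFlowDisp v φ) (hm : Integrable m unitVolume)
    (hv : FieldCkBound k γ m v) (x : E) : Integrable (fun s => v s (x + φ s x)) unitVolume :=
  hv.integrable_comp hm (continuous_const.add (hφ.cont x))

theorem norm_le (hφ : IsFlowDisp v φ) (hm : Integrable m unitVolume) (hm0 : ∀ s, 0 ≤ m s)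
    (hR : ∫ s, m s ∂unitVolume ≤ R) (hv : FieldCkBound k γ m v) {t : ℝ} (ht : t ∈ Icc (0 : ℝ) 1)
    (x : E) : ‖φ t x‖ ≤ R := by
  rw [hφ.eq x t ht]
  refine ((norm_intervalIntegral_le hm (hv.ae.mono fun s hs => hs.holderBound.bound _) (by simp) ht
    ht.1).trans (intervalIntegral_le_integral hm hm0 (by simp) ht ht.1)).trans hR

/-- Varying the field and the starting point together yields in one estimate the Lipschitz bound in
space, uniqueness, and Lipschitz dependence on the field in the sup norm. Only `v` has to be
Lipschitz. -/
theorem norm_sub_le_of_field {v' φ' : ℝ → E → E} {m' : ℝ → ℝ} (hφ : IsFlowDisp v φ)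
    (hφ' : IsFlowDisp v' φ') (hm : Integrable m unitVolume) (hm0 : ∀ s, 0 ≤ m s)
    (hR : ∫ s, m s ∂unitVolume ≤ R) (hv : FieldCkBound (k + 1) γ m v)
    (hm' : Integrable m' unitVolume) (hv' : FieldCkBound k γ m' v')
    (hq : Integrable q unitVolume) (hq0 : ∀ s, 0 ≤ q s)
    (hd : ∀ᵐ s ∂unitVolume, ∀ z, ‖v s z - v' s z‖ ≤ q s)
    {t : ℝ} (ht : t ∈ Icc (0 : ℝ) 1) (x y : E) :
    ‖φ t x - φ' t y‖ ≤ gronwallConst R * (R * ‖x - y‖ + ∫ s, q s ∂unitVolume) := by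
  refine (norm_le_of_integral_eq (y := fun t => φ t x - φ' t y)
    (w := fun s => v s (x + φ s x) - v' s (y + φ' s y)) (ρ := fun s => m s * ‖x - y‖ + q s) hm hm0 hR
    ((hm.mul_const _).add hq) (fun s => by have := hm0 s; have := hq0 s; positivity)
    ((hφ.cont x).sub (hφ'.cont y)) (fun t ht => ?_) ?_ t ht).trans ?_
  · rw [intervalIntegral.integral_sub
      (intervalIntegrable_of_integrable (hφ.integrable hm hv x) (by simp) ht)
      (intervalIntegrable_of_integrable (hφ'.integrable hm' hv' y) (by simp) ht),
      hφ.eq x t ht, hφ'.eq y t ht]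
  · filter_upwards [hv.ae, hd] with s hs h2
    have e1 := norm_sub_le_norm_sub_add_norm_sub (v s (x + φ s x)) (v s (y + φ' s y))
      (v' s (y + φ' s y))
    have e2 := hs.norm_sub_le (x + φ s x) (y + φ' s y)
    have e3 : ‖(x + φ s x) - (y + φ' s y)‖ ≤ ‖x - y‖ + ‖φ s x - φ' s y‖ := by
      rw [add_sub_add_comm]
      exact norm_add_le _ _
    have e4 := mul_le_mul_of_nonneg_left e3 (hm0 s)
    linarith [h2 (y + φ' s y)]
  · rw [integral_add (hm.mul_const _) hq, integral_mul_const]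
    have := gronwallConst_nonneg R
    gcongr

theorem norm_sub_le (hφ : IsFlowDisp v φ) (hm : Integrable m unitVolume) (hm0 : ∀ s, 0 ≤ m s)
    (hR : ∫ s, m s ∂unitVolume ≤ R) (hv : FieldCkBound (k + 1) γ m v) {t : ℝ}
    (ht : t ∈ Icc (0 : ℝ) 1) (x y : E) :
    ‖φ t x - φ t y‖ ≤ gronwallConst R * R * ‖x - y‖ := by
  have := hφ.norm_sub_le_of_field hφ hm hm0 hR hv hm (hv.of_le k.le_succ) (q := fun _ => 0)
    (integrable_zero _ _ _) (fun _ => le_rfl) (by simp) ht x y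
  simpa [mul_assoc] using this

/-- Properness holds because the displacement is bounded, by the mass `R` of the field. -/
theorem admissible (hφ : IsFlowDisp v φ) (hm : Integrable m unitVolume) (hm0 : ∀ s, 0 ≤ m s)
    (hR : ∫ s, m s ∂unitVolume ≤ R) (hv : FieldCkBound (k + 1) γ m v) :
    AdmissibleDisp (flowLipConst R) φ where
  cont := hφ.cont
  lip s hs x y := by
    rw [add_sub_add_comm, flowLipConst, add_mul, one_mul]
    exact (norm_add_le _ _).trans (add_le_add_right (hφ.norm_sub_le hm hm0 hR hv hs x y) _)
  tendsto s hs := by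
    rw [← tendsto_norm_atTop_iff_cobounded]
    refine tendsto_atTop_mono (fun x => ?_)
      (tendsto_atTop_add_const_right _ (-R) tendsto_norm_cobounded_atTop)
    have h1 := hφ.norm_le hm hm0 hR hv hs x
    have h2 := norm_sub_le_norm_add x (φ s x)
    linarith

/-- Along a known flow the right side is a given inhomogeneity, so the linear theory applies with
zero coefficient and yields Hölder bounds and decay of `φ`. -/
theorem solvesLinear (hφ : IsFlowDisp v φ) :
    SolvesLinear 0 (fun s x => v s (x + φ s x)) φ :=
  ⟨hφ.cont, fun x t ht => by simpa using hφ.eq x t ht⟩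

/-- The remainder `φ t x' - φ t x - g t x (x' - x)` solves a linear equation whose coefficient is
the derivative of `v s` at `x + φ s x` and whose inhomogeneity is the Taylor remainder of `v s`
there. The latter is little-o at almost every time since `id + φ s` is Lipschitz. -/
theorem exists_hasFDerivAt [FiniteDimensional ℝ E] (hφ : IsFlowDisp v φ)
    (hm : Integrable m unitVolume) (hm0 : ∀ s, 0 ≤ m s) (h0 : 0 ≤ γ) (h1 : γ ≤ 1)
    (hv : FieldCkBound (k + 1) γ m v) :
    ∃ g : ℝ → E → E →L[ℝ] E, SolvesLinear
        (fun s x => ContinuousLinearMap.compL ℝ E E E (fderiv ℝ (v s) (x + φ s x)))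
        (fun s x => fderiv ℝ (v s) (x + φ s x)) g ∧
      ∀ t ∈ Icc (0 : ℝ) 1, ∀ x, HasFDerivAt (φ t) (g t x) x := by
  have := FiniteDimensional.complete ℝ E
  set R := ∫ s, m s ∂unitVolume with hRdef
  have hR0 : 0 ≤ R := integral_nonneg hm0
  have hadm := hφ.admissible hm hm0 le_rfl hv
  have hK := one_le_flowLipConst hR0
  have hA : TimeCkBound 0 γ (fun s => flowLipConst R * m s)
      (fun s x => fderiv ℝ (v s) (x + φ s x)) := by
    refine ⟨fun x => hv.fderiv.meas _ (continuous_const.add (hφ.cont x)), ?_⟩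
    filter_upwards [hv.ae, ae_restrict_mem measurableSet_Icc] with s hs hs'
      using HolderBound.comp hs.2.2.holderBound h0 h1 hK (hadm.lip s hs') (hadm.tendsto s hs')
  have hA' := hA.clm_comp _ (ContinuousLinearMap.norm_compL_le ℝ E E E)
  have hm' : Integrable (fun s => flowLipConst R * m s) unitVolume := hm.const_mul _
  have hm'0 : ∀ s, 0 ≤ flowLipConst R * m s := fun s => mul_nonneg (by linarith) (hm0 s)
  obtain ⟨g, hg⟩ := exists_solvesLinear hm' hm'0 hm' hA' hA
  refine ⟨g, hg, fun t ht x => ?_⟩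
  set ρ : E → ℝ → ℝ := fun x' s => ‖v s (x' + φ s x') - v s (x + φ s x) -
    fderiv ℝ (v s) (x + φ s x) ((x' + φ s x') - (x + φ s x))‖ with hρ
  have hΦc : ∀ x, Continuous fun s => x + φ s x := fun x => continuous_const.add (hφ.cont x)
  have hρm : ∀ x', AEStronglyMeasurable (ρ x') unitVolume := fun x' =>
    (((hv.meas _ (hΦc x')).sub (hv.meas _ (hΦc x))).sub
      ((ContinuousLinearMap.id ℝ (E →L[ℝ] E)).aestronglyMeasurable_comp₂ (hA.meas x)
        ((hΦc x').sub (hΦc x)).aestronglyMeasurable)).norm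
  have hρ0 : ∀ x' s, 0 ≤ ρ x' s := fun x' s => norm_nonneg _
  have hρD : ∀ᵐ s ∂unitVolume, ∀ x', ρ x' s ≤ (2 * (flowLipConst R * m s)) * ‖x' - x‖ := by
    filter_upwards [hv.ae, ae_restrict_mem measurableSet_Icc] with s hs hs' x'
    have e1 := hs.norm_taylor_le (x + φ s x) (x' + φ s x')
    have e2 := mul_le_mul_of_nonneg_left (hadm.lip s hs' x' x) (hm0 s)
    simp only [hρ]
    linarith
  have hDi : Integrable (fun s => 2 * (flowLipConst R * m s)) unitVolume := hm'.const_mul _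
  have hρi : ∀ x', Integrable (ρ x') unitVolume := fun x' =>
    (hDi.mul_const ‖x' - x‖).mono' (hρm x') (hρD.mono fun s hs => by
      rw [Real.norm_of_nonneg (hρ0 x' s)]
      exact hs x')
  refine hasFDerivAt_of_norm_le_integral (κ := gronwallConst R) hDi
    (fun s => mul_nonneg zero_le_two (hm'0 s)) hρm hρ0 hρD ?_ fun x' => ?_
  · filter_upwards [hv.ae, ae_restrict_mem measurableSet_Icc] with s hs hs'
    have e1 := hasFDerivAt_iff_isLittleO.1 (hs.2.1 (x + φ s x)).hasFDerivAt
    have e2 : (fun x' => (x' + φ s x') - (x + φ s x)) =O[𝓝 x] fun x' => x' - x :=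
      Asymptotics.IsBigO.of_bound _ (Eventually.of_forall fun x' => hadm.lip s hs' x' x)
    have e3 : Tendsto (fun x' => x' + φ s x') (𝓝 x) (𝓝 (x + φ s x)) := by
      rw [tendsto_iff_norm_sub_tendsto_zero]
      refine squeeze_zero (fun _ => norm_nonneg _) (fun x' => hadm.lip s hs' x' x) ?_
      have : Tendsto (fun x' => x' - x) (𝓝 x) (𝓝 0) := by
        simpa using (continuous_id.sub continuous_const).tendsto (f := fun x' : E => x' - x) x
      simpa using this.norm.const_mul (flowLipConst R)
    exact ((e1.comp_tendsto e3).trans_isBigO e2).norm_left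
  · refine norm_le_of_integral_eq (y := fun t => φ t x' - φ t x - g t x (x' - x))
      (w := fun s => v s (x' + φ s x') - v s (x + φ s x) -
        ((fderiv ℝ (v s) (x + φ s x)).comp (g s x) + fderiv ℝ (v s) (x + φ s x)) (x' - x))
      hm hm0 le_rfl (hρi x') (hρ0 x')
      (((hφ.cont x').sub (hφ.cont x)).sub ((hg.cont x).clm_apply continuous_const))
      (fun t ht => ?_) ?_ t ht
    · have i1 := intervalIntegrable_of_integrable (hφ.integrable hm hv x') (a := 0) (by simp) ht
      have i2 := intervalIntegrable_of_integrable (hφ.integrable hm hv x) (a := 0) (by simp) ht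
      have hgi := hg.integrable hm' hm' hA' hA x
      have i3 := intervalIntegrable_of_integrable hgi (a := 0) (by simp) ht
      simp only [ContinuousLinearMap.compL_apply] at hgi i3
      rw [intervalIntegral.integral_sub (i1.sub i2)
        (intervalIntegrable_of_integrable (hgi.apply_continuousLinearMap _) (by simp) ht),
        intervalIntegral.integral_sub i1 i2, ← ContinuousLinearMap.intervalIntegral_apply i3,
        hφ.eq x' t ht, hφ.eq x t ht, hg.eq x t ht]
      rfl
    · filter_upwards [hv.ae] with s hs
      have e : v s (x' + φ s x') - v s (x + φ s x) -
          ((fderiv ℝ (v s) (x + φ s x)).comp (g s x) + fderiv ℝ (v s) (x + φ s x)) (x' - x) =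
          fderiv ℝ (v s) (x + φ s x) (φ s x' - φ s x - g s x (x' - x)) +
          (v s (x' + φ s x') - v s (x + φ s x) -
            fderiv ℝ (v s) (x + φ s x) ((x' + φ s x') - (x + φ s x))) := by
        simp only [map_sub, map_add, _root_.add_apply, ContinuousLinearMap.comp_apply]
        abel
      rw [e]
      exact (norm_add_le _ _).trans (add_le_add_left
        (ContinuousLinearMap.le_of_opNorm_le _ (hs.2.2.holderBound.bound _) _) _)

theorem holderBound [FiniteDimensional ℝ E] (hφ : IsFlowDisp v φ) (hm : Integrable m unitVolume)
    (hm0 : ∀ s, 0 ≤ m s)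
    (hR : ∫ s, m s ∂unitVolume ≤ R) (h0 : 0 ≤ γ) (h1 : γ ≤ 1) (hv : FieldCkBound (k + 1) γ m v)
    {t : ℝ} (ht : t ∈ Icc (0 : ℝ) 1) :
    HolderBound γ (gronwallConst 0 * (flowLipConst R * R)) (φ t) := by
  have := FiniteDimensional.complete ℝ E
  have hR0 : 0 ≤ R := (integral_nonneg hm0).trans hR
  have hadm := hφ.admissible hm hm0 hR hv
  have hK := one_le_flowLipConst hR0
  have hb : TimeCkBound 0 γ (fun s => flowLipConst R * m s) (fun s x => v s (x + φ s x)) := by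
    refine ⟨fun x => hv.meas _ (continuous_const.add (hφ.cont x)), ?_⟩
    filter_upwards [hv.ae, ae_restrict_mem measurableSet_Icc] with s hs hs'
      using HolderBound.comp hs.holderBound h0 h1 hK (hadm.lip s hs') (hadm.tendsto s hs')
  have hA : TimeCkBound 0 γ (fun _ => 0) (0 : ℝ → E → E →L[ℝ] E) :=
    ⟨fun _ => aestronglyMeasurable_const, ae_of_all _ fun _ => CkBound.zero le_rfl⟩
  refine (hφ.solvesLinear.holderBound (R := 0) (integrable_zero _ _ _) (fun _ => le_rfl) (by simp)
    (hm.const_mul _) (fun s => mul_nonneg (by linarith) (hm0 s)) hA hb ht).mono ?_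
  rw [integral_const_mul, zero_mul, add_zero, mul_one]
  have := gronwallConst_nonneg 0
  gcongr

/-- Regularity of the flow in the space variable. -/
theorem ckBound [FiniteDimensional ℝ E] {n : ℕ} {γ : ℝ} (h0 : 0 ≤ γ) (h1 : γ ≤ 1) {R : ℝ}
    (hR0 : 0 ≤ R) (k : ℕ) (hk : k ≤ n + 1) :
    ∃ C : ℝ, 0 ≤ C ∧ ∀ {v φ : ℝ → E → E} {m : ℝ → ℝ}, IsFlowDisp v φ → Integrable m unitVolume →
      (∀ s, 0 ≤ m s) → ∫ s, m s ∂unitVolume ≤ R → FieldCkBound (n + 1) γ m v →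
      ∀ t ∈ Icc (0 : ℝ) 1, CkBound k γ C (φ t) := by
  have := FiniteDimensional.complete ℝ E
  have hK := one_le_flowLipConst hR0
  have hC0 : 0 ≤ gronwallConst 0 * (flowLipConst R * R) :=
    mul_nonneg (gronwallConst_nonneg 0) (mul_nonneg (by linarith) hR0)
  induction k with
  | zero =>
    exact ⟨_, hC0, fun hφ hm hm0 hR hv t ht => hφ.holderBound hm hm0 hR h0 h1 hv ht⟩
  | succ k ih =>
    obtain ⟨C, hC, ih⟩ := ih (by omega)
    obtain ⟨c, hc, hcomp⟩ := FieldCkBound.comp (E := E) k h0 h1 hK hC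
    obtain ⟨c', hc', hlin⟩ := SolvesLinear.ckBound (E := E) k (R := c * R) (by positivity) γ
    refine ⟨gronwallConst 0 * (flowLipConst R * R) + c' * (c * R), by positivity,
      fun {v φ m} hφ hm hm0 hR hv t ht => ?_⟩
    have hadm := hφ.admissible hm hm0 hR hv
    -- The bootstrap: order `k` for `φ` gives order `k` for the coefficient of the variational
    -- equation, hence for its solution, the derivative of `φ`.
    have hA := hcomp (hv.fderiv.of_le (by omega : k ≤ n)) hadm (ih hφ hm hm0 hR hv)
    obtain ⟨g, hg, hder⟩ := hφ.exists_hasFDerivAt hm hm0 h0 h1 hv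
    have hint : ∫ s, c * m s ∂unitVolume ≤ c * R := by
      rw [integral_const_mul]
      gcongr
    have hnn : ∀ s, 0 ≤ c * m s := fun s => mul_nonneg (by linarith) (hm0 s)
    have hgk := hlin hg (hm.const_mul c) hnn hint (hm.const_mul c) hnn
      (hA.clm_comp _ (ContinuousLinearMap.norm_compL_le ℝ E E E)) hA t ht
    refine ⟨(hφ.holderBound hm hm0 hR h0 h1 hv ht).mono (le_add_of_nonneg_right (by positivity)),
      fun x => (hder t ht x).differentiableAt, ?_⟩
    rw [show fderiv ℝ (φ t) = g t from funext fun x => (hder t ht x).fderiv]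
    refine hgk.mono ?_
    have := mul_le_mul_of_nonneg_left hint hc'
    linarith

/-- Two flows are close to the order `γ` in the `C^k`-norm if their fields are close. -/
theorem ckBound_sub [FiniteDimensional ℝ E] {n : ℕ} {γ : ℝ} (h0 : 0 ≤ γ) (h1 : γ ≤ 1) {R : ℝ}
    (hR0 : 0 ≤ R) (k : ℕ) (hk : k ≤ n + 1) :
    ∃ C : ℝ, 0 ≤ C ∧ ∀ {v v' φ φ' : ℝ → E → E} {m m' q : ℝ → ℝ}, IsFlowDisp v φ →
      IsFlowDisp v' φ' → Integrable m unitVolume →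
      (∀ s, 0 ≤ m s) → ∫ s, m s ∂unitVolume ≤ R → FieldCkBound (n + 1) γ m v →
      Integrable m' unitVolume → (∀ s, 0 ≤ m' s) → ∫ s, m' s ∂unitVolume ≤ R →
      FieldCkBound (n + 1) γ m' v' → Integrable q unitVolume → (∀ s, 0 ≤ q s) →
      ∫ s, q s ∂unitVolume ≤ 1 → FieldCkBound (n + 1) γ q (fun s x => v s x - v' s x) →
      ∀ t ∈ Icc (0 : ℝ) 1,
        CkBound k 0 (C * (∫ s, q s ∂unitVolume) ^ γ) (fun x => φ t x - φ' t x) := by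
  have := FiniteDimensional.complete ℝ E
  have hK := one_le_flowLipConst hR0
  have hκ : 1 ≤ gronwallConst R := by
    have := Real.one_le_exp (show 0 ≤ 2 * R by positivity)
    unfold gronwallConst
    linarith
  have base : ∀ {v v' φ φ' : ℝ → E → E} {m m' q : ℝ → ℝ}, IsFlowDisp v φ →
      IsFlowDisp v' φ' → Integrable m unitVolume →
      (∀ s, 0 ≤ m s) → ∫ s, m s ∂unitVolume ≤ R → FieldCkBound (n + 1) γ m v →
      Integrable m' unitVolume → (∀ s, 0 ≤ m' s) → ∫ s, m' s ∂unitVolume ≤ R →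
      FieldCkBound (n + 1) γ m' v' → Integrable q unitVolume → (∀ s, 0 ≤ q s) →
      FieldCkBound (n + 1) γ q (fun s x => v s x - v' s x) →
      ∀ t ∈ Icc (0 : ℝ) 1, ∀ x, ‖φ t x - φ' t x‖ ≤ gronwallConst R * ∫ s, q s ∂unitVolume := by
    intro v v' φ φ' m m' q hφ hφ' hm hm0 hR hv hm' hm'0 hR' hv' hq hq0 hd t ht x
    simpa using hφ.norm_sub_le_of_field hφ' hm hm0 hR hv hm' (hv'.of_le n.le_succ) hq hq0
      (hd.ae.mono fun s hs => hs.holderBound.bound) ht x x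
  -- Mass at most `1` lets the contributions that are linear in the distance of the fields be
  -- absorbed in its power `γ`.
  have hpow : ∀ {D : ℝ}, 0 ≤ D → D ≤ 1 → D ≤ D ^ γ := fun {D} hD hD1 => by
    rcases eq_or_lt_of_le hD with h | h
    · rw [← h]
      exact Real.rpow_nonneg le_rfl _
    · simpa using Real.rpow_le_rpow_of_exponent_ge h hD1 h1
  have base0 : ∀ {v v' φ φ' : ℝ → E → E} {m m' q : ℝ → ℝ}, IsFlowDisp v φ →
      IsFlowDisp v' φ' → Integrable m unitVolume →
      (∀ s, 0 ≤ m s) → ∫ s, m s ∂unitVolume ≤ R → FieldCkBound (n + 1) γ m v →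
      Integrable m' unitVolume → (∀ s, 0 ≤ m' s) → ∫ s, m' s ∂unitVolume ≤ R →
      FieldCkBound (n + 1) γ m' v' → Integrable q unitVolume → (∀ s, 0 ≤ q s) →
      ∫ s, q s ∂unitVolume ≤ 1 → FieldCkBound (n + 1) γ q (fun s x => v s x - v' s x) →
      ∀ t ∈ Icc (0 : ℝ) 1,
        HolderBound 0 (2 * gronwallConst R * (∫ s, q s ∂unitVolume) ^ γ)
          (fun x => φ t x - φ' t x) := by
    intro v v' φ φ' m m' q hφ hφ' hm hm0 hR hv hm' hm'0 hR' hv' hq hq0 hD1 hd t ht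
    have hD0 : 0 ≤ ∫ s, q s ∂unitVolume := integral_nonneg hq0
    have hb := base hφ hφ' hm hm0 hR hv hm' hm'0 hR' hv' hq hq0 hd t ht
    have hb' : ∀ x, ‖φ t x - φ' t x‖ ≤ gronwallConst R * (∫ s, q s ∂unitVolume) ^ γ := fun x =>
      (hb x).trans (mul_le_mul_of_nonneg_left (hpow hD0 hD1) (by linarith))
    refine ⟨fun x => (hb' x).trans ?_, fun x y => ?_, ?_⟩
    · have := (norm_nonneg _).trans (hb' x)
      linarith
    · rw [Real.rpow_zero, mul_one]
      refine (_root_.norm_sub_le _ _).trans ?_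
      linarith [hb' x, hb' y]
    · simpa using (hφ.holderBound hm hm0 hR h0 h1 hv ht).decay.sub
        (hφ'.holderBound hm' hm'0 hR' h0 h1 hv' ht).decay
  induction k with
  | zero => exact ⟨2 * gronwallConst R, by positivity, base0⟩
  | succ k ih =>
    obtain ⟨C₁, hC₁, ih⟩ := ih (by omega)
    obtain ⟨C, hC, hck⟩ := IsFlowDisp.ckBound (E := E) h0 h1 hR0 k (n := n) (by omega)
    obtain ⟨C', hC', hck'⟩ := IsFlowDisp.ckBound (E := E) h0 h1 hR0 (k + 1) (n := n) hk
    obtain ⟨c, hc, hcomp⟩ := FieldCkBound.comp (E := E) k le_rfl zero_le_one hK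
      (show 0 ≤ 2 * C by positivity)
    obtain ⟨c₁, hc₁, hcomp₁⟩ := FieldCkBound.comp_sub_comp (E := E) k h0 hK
      (show 0 ≤ 2 * C by positivity)
    obtain ⟨c₂, hc₂, hlin⟩ := SolvesLinear.ckBound (E := E) k (R := c * (2 * R))
      (by positivity) 0
    -- One constant for both hypotheses of the composition estimate: the `γ`-th power of the sup
    -- distance, where `gronwallConst R ^ γ ≤ gronwallConst R`, and the `C^k` distance from the
    -- induction hypothesis.
    set C₂ := gronwallConst R + C₁ with hC₂
    have hC₂0 : 0 ≤ C₂ := by positivity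
    refine ⟨2 * gronwallConst R + c₂ * ((2 ^ (k + 1) * (2 * C') + 1) * (c * 2 + c₁ * (R * C₂))),
      by positivity,
      fun {v v' φ φ' m m' q} hφ hφ' hm hm0 hR hv hm' hm'0 hR' hv' hq hq0 hD1 hd t ht => ?_⟩
    have hD0 : 0 ≤ ∫ s, q s ∂unitVolume := integral_nonneg hq0
    have hb := base hφ hφ' hm hm0 hR hv hm' hm'0 hR' hv' hq hq0 hd
    have hb0 := base0 hφ hφ' hm hm0 hR hv hm' hm'0 hR' hv' hq hq0 hD1 hd t ht
    have hih := ih hφ hφ' hm hm0 hR hv hm' hm'0 hR' hv' hq hq0 hD1 hd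
    set D := ∫ s, q s ∂unitVolume with hDdef
    have hDγ : 0 ≤ D ^ γ := Real.rpow_nonneg hD0 γ
    have hadm := hφ.admissible hm hm0 hR hv
    have hadm' := hφ'.admissible hm' hm'0 hR' hv'
    have hδ : ∀ s ∈ Icc (0 : ℝ) 1, ∀ x, ‖φ s x - φ' s x‖ ^ γ ≤ C₂ * D ^ γ := fun s hs x => by
      calc ‖φ s x - φ' s x‖ ^ γ ≤ (gronwallConst R * D) ^ γ := by gcongr; exact hb s hs x
        _ = gronwallConst R ^ γ * D ^ γ := Real.mul_rpow (by linarith) hD0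
        _ ≤ gronwallConst R ^ (1 : ℝ) * D ^ γ := by gcongr
        _ ≤ _ := by
          rw [Real.rpow_one]
          gcongr
          linarith
    have hih' : ∀ s ∈ Icc (0 : ℝ) 1, CkBound k 0 (C₂ * D ^ γ) (fun x => φ s x - φ' s x) :=
      fun s hs => (hih s hs).mono (by gcongr; linarith)
    have hφC : ∀ s ∈ Icc (0 : ℝ) 1, CkBound k 0 (2 * C) (φ s) := fun s hs =>
      (hck hφ hm hm0 hR hv s hs).mono_exponent le_rfl h0
    have hφC' : ∀ s ∈ Icc (0 : ℝ) 1, CkBound k 0 (2 * C) (φ' s) := fun s hs =>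
      (hck hφ' hm' hm'0 hR' hv' s hs).mono_exponent le_rfl h0
    obtain ⟨g, hg, hder⟩ := hφ.exists_hasFDerivAt hm hm0 h0 h1 hv
    obtain ⟨g', hg', hder'⟩ := hφ'.exists_hasFDerivAt hm' hm'0 h0 h1 hv'
    have hfg' : ∀ s ∈ Icc (0 : ℝ) 1, fderiv ℝ (φ' s) = g' s := fun s hs =>
      funext fun x => (hder' s hs x).fderiv
    have hg'C : ∀ s ∈ Icc (0 : ℝ) 1, CkBound k 0 (2 * C') (g' s) := fun s hs => by
      rw [← hfg' s hs]
      exact ((hck' hφ' hm' hm'0 hR' hv' s hs).mono_exponent le_rfl h0).2.2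
    have hA := hcomp ((hv.fderiv.of_le (by omega : k ≤ n)).mono_exponent le_rfl h0) hadm hφC
    have hA' := hcomp ((hv'.fderiv.of_le (by omega : k ≤ n)).mono_exponent le_rfl h0) hadm' hφC'
    have hB₁ := hcomp ((hd.fderiv.of_le (by omega : k ≤ n)).mono_exponent le_rfl h0) hadm hφC
    have hB₂ := hcomp₁ (hv'.fderiv.of_le (by omega : k ≤ n)) hadm hadm' hφC hφC' hδ hih'
    set p : ℝ → ℝ := fun s => c * (2 * q s) + c₁ * (m' s * (C₂ * D ^ γ)) with hp
    -- The coefficients differ because the fields differ, compared along the same flow, and because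
    -- the flows differ, compared for the same field `v'`. The second part is where only the power
    -- `γ` survives.
    have hB : TimeCkBound k 0 p (fun s x =>
        fderiv ℝ (v s) (x + φ s x) - fderiv ℝ (v' s) (x + φ' s x)) := by
      refine (hB₁.add hB₂).congr ?_
      filter_upwards [hv.ae, hv'.ae] with s hs hs'
      funext x
      rw [fderiv_fun_sub (hs.2.1 _) (hs'.2.1 _)]
      abel
    have hpi : Integrable p unitVolume :=
      ((hq.const_mul _).const_mul _).add ((hm'.mul_const _).const_mul _)
    have hp0 : ∀ s, 0 ≤ p s := fun s => by
      have := hq0 s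
      have := hm'0 s
      positivity
    have hL := ContinuousLinearMap.norm_compL_le ℝ E E E
    have hb' := (hB.bilinear hg'.cont hg'C _ hL).add hB
    -- The difference of the derivatives solves the variational equation of `v` with the difference
    -- of the coefficients as source, multiplied by `g'` and alone.
    have hsol : SolvesLinear
        (fun s x => ContinuousLinearMap.compL ℝ E E E (fderiv ℝ (v s) (x + φ s x)))
        (fun s x => ContinuousLinearMap.compL ℝ E E E
          (fderiv ℝ (v s) (x + φ s x) - fderiv ℝ (v' s) (x + φ' s x)) (g' s x) +
          (fderiv ℝ (v s) (x + φ s x) - fderiv ℝ (v' s) (x + φ' s x)))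
        (fun s x => g s x - g' s x) := by
      refine ⟨fun x => (hg.cont x).sub (hg'.cont x), fun x t ht => ?_⟩
      have i1 := hg.integrable ((hm.const_mul 2).const_mul c) ((hm.const_mul 2).const_mul c)
        (hA.clm_comp _ hL) hA x
      have i2 := hg'.integrable ((hm'.const_mul 2).const_mul c) ((hm'.const_mul 2).const_mul c)
        (hA'.clm_comp _ hL) hA' x
      rw [hg.eq x t ht, hg'.eq x t ht, ← intervalIntegral.integral_sub
        (intervalIntegrable_of_integrable i1 (by simp) ht)
        (intervalIntegrable_of_integrable i2 (by simp) ht)]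
      congr 1
      funext s
      simp only [map_sub, _root_.sub_apply]
      abel
    have hpi' : Integrable (fun s => 2 ^ (k + 1) * (p s * (2 * C')) + p s) unitVolume :=
      ((hpi.mul_const _).const_mul _).add hpi
    have hres := hlin hsol ((hm.const_mul 2).const_mul c)
      (fun s => by have := hm0 s; positivity)
      (by rw [integral_const_mul, integral_const_mul]; gcongr)
      hpi' (fun s => by have := hp0 s; positivity)
      (hA.clm_comp _ hL) hb' t ht
    refine ⟨hb0.mono ?_, fun x => ((hder t ht x).sub (hder' t ht x)).differentiableAt, ?_⟩
    · gcongr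
      exact le_add_of_nonneg_right (by positivity)
    · rw [show fderiv ℝ (fun x => φ t x - φ' t x) = fun x => g t x - g' t x from
        funext fun x => ((hder t ht x).fun_sub (hder' t ht x)).fderiv]
      refine hres.mono ?_
      have e1 : ∫ s, p s ∂unitVolume ≤ (c * 2 + c₁ * (R * C₂)) * D ^ γ := by
        rw [integral_add ((hq.const_mul _).const_mul _) ((hm'.mul_const _).const_mul _),
          integral_const_mul, integral_const_mul, integral_const_mul, integral_mul_const]
        calc _ ≤ c * (2 * D ^ γ) + c₁ * (R * (C₂ * D ^ γ)) := by
              gcongr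
              exact hpow hD0 hD1
          _ = _ := by ring
      rw [integral_add ((hpi.mul_const _).const_mul _) hpi, integral_const_mul,
        integral_mul_const]
      calc _ = c₂ * ((2 ^ (k + 1) * (2 * C') + 1) * ∫ s, p s ∂unitVolume) := by ring
        _ ≤ c₂ * ((2 ^ (k + 1) * (2 * C') + 1) * ((c * 2 + c₁ * (R * C₂)) * D ^ γ)) := by gcongr
        _ = c₂ * ((2 ^ (k + 1) * (2 * C') + 1) * (c * 2 + c₁ * (R * C₂))) * D ^ γ := by ring
        _ ≤ _ := by
          gcongr
          exact le_add_of_nonneg_left (by positivity)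

end IsFlowDisp

end FlowEquation

/-! ### The flow as a continuous curve of diffeomorphisms, and its dependence on the field. -/

section FlowMap

variable {E : Type} [NormedAddCommGroup E] [NormedSpace ℝ E]
  {k : ℕ} {γ R C : ℝ} {m : ℝ → ℝ} {v φ : ℝ → E → E}

/-- The increment between two times is the value at time `1` of the linear equation with zero
coefficient whose source is cut off to `Ioc t₁ t₂`. The regularity theorem for linear equations then
bounds it by the mass of the field on that interval. -/
theorem IsFlowDisp.ckBound_sub_time [FiniteDimensional ℝ E] (h0 : 0 ≤ γ) (h1 : γ ≤ 1)
    (hφ : IsFlowDisp v φ) (hm : Integrable m unitVolume) (hm0 : ∀ s, 0 ≤ m s)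
    (hv : FieldCkBound (k + 1) γ m v) :
    ∃ C : ℝ, 0 ≤ C ∧ ∀ t₁ ∈ Icc (0 : ℝ) 1, ∀ t₂ ∈ Icc (0 : ℝ) 1, t₁ ≤ t₂ →
      CkBound (k + 1) γ (C * ∫ s in t₁..t₂, m s) (fun x => φ t₂ x - φ t₁ x) := by
  have := FiniteDimensional.complete ℝ E
  set R := ∫ s, m s ∂unitVolume with hR
  have hR0 : 0 ≤ R := integral_nonneg hm0
  obtain ⟨C, hC, hck⟩ := IsFlowDisp.ckBound (E := E) h0 h1 hR0 (k + 1) (n := k) le_rfl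
  obtain ⟨c, hc, hcomp⟩ := FieldCkBound.comp (E := E) (k + 1) h0 h1 (one_le_flowLipConst hR0) hC
  obtain ⟨c', hc', hlin⟩ := SolvesLinear.ckBound (E := E) (k + 1) (le_refl (0 : ℝ)) γ
  refine ⟨c' * c, by positivity, fun t₁ ht₁ t₂ ht₂ h12 => ?_⟩
  have hb := hcomp hv (hφ.admissible hm hm0 le_rfl hv) (hck hφ hm hm0 le_rfl hv)
  have hA : TimeCkBound (k + 1) γ (fun _ => 0) (0 : ℝ → E → E →L[ℝ] E) :=
    ⟨fun _ => aestronglyMeasurable_const, ae_of_all _ fun _ => CkBound.zero le_rfl⟩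
  have hb' : TimeCkBound (k + 1) γ (fun s => (Ioc t₁ t₂).indicator (fun s => c * m s) s)
      (fun s x => (Ioc t₁ t₂).indicator (fun s => v s (x + φ s x)) s) := by
    refine ⟨fun x => (hb.meas x).indicator measurableSet_Ioc, ?_⟩
    filter_upwards [hb.ae] with s hs
    by_cases hs' : s ∈ Ioc t₁ t₂
    · simpa [hs'] using hs
    · simpa [hs'] using CkBound.zero le_rfl
  have hq : Integrable (fun s => (Ioc t₁ t₂).indicator (fun s => c * m s) s) unitVolume :=
    (hm.const_mul c).indicator measurableSet_Ioc
  have hq0 : ∀ s, 0 ≤ (Ioc t₁ t₂).indicator (fun s => c * m s) s := fun s =>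
    indicator_nonneg (fun s _ => mul_nonneg (by linarith) (hm0 s)) s
  obtain ⟨f, hf⟩ := exists_solvesLinear (integrable_zero _ _ _) (fun _ => le_rfl) hq hA hb'
  have hres := hlin hf (integrable_zero _ _ _) (fun _ => le_rfl) (by simp) hq hq0 hA hb' 1
    (by simp)
  have hsub : Ioc t₁ t₂ ⊆ Ioc 0 1 := Ioc_subset_Ioc ht₁.1 ht₂.2
  have hind : ∀ {G : Type} [NormedAddCommGroup G] [NormedSpace ℝ G] (w : ℝ → G),
      ∫ s in (0 : ℝ)..1, (Ioc t₁ t₂).indicator w s = ∫ s in t₁..t₂, w s := fun w => by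
    rw [intervalIntegral.integral_of_le zero_le_one, intervalIntegral.integral_of_le h12,
      setIntegral_indicator measurableSet_Ioc, inter_eq_self_of_subset_right hsub]
  have hf1 : f 1 = fun x => φ t₂ x - φ t₁ x := by
    funext x
    have hi := hφ.integrable hm hv x
    rw [hf.eq x 1 (by simp), hφ.eq x t₂ ht₂, hφ.eq x t₁ ht₁,
      intervalIntegral.integral_interval_sub_left
        (intervalIntegrable_of_integrable hi (by simp) ht₂)
        (intervalIntegrable_of_integrable hi (by simp) ht₁)]
    simpa using hind fun s => v s (x + φ s x)
  rw [hf1] at hres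
  refine hres.mono (le_of_eq ?_)
  rw [integral_Icc_eq_integral_Ioc, ← intervalIntegral.integral_of_le zero_le_one, hind,
    intervalIntegral.integral_const_mul, mul_assoc]

/-- The determinant is `1` at time `0`, is continuous in time and never vanishes, so it stays
positive by the intermediate value theorem. -/
theorem IsFlowDisp.det_pos [FiniteDimensional ℝ E] (h0 : 0 ≤ γ) (h1 : γ ≤ 1)
    (hφ : IsFlowDisp v φ) (hm : Integrable m unitVolume) (hm0 : ∀ s, 0 ≤ m s)
    (hv : FieldCkBound (k + 1) γ m v) {t : ℝ} (ht : t ∈ Icc (0 : ℝ) 1) (x : E) :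
    0 < (fderiv ℝ (fun y => y + φ t y) x).det := by
  have := FiniteDimensional.complete ℝ E
  obtain ⟨g, hg, hder⟩ := hφ.exists_hasFDerivAt hm hm0 h0 h1 hv
  have hfd : fderiv ℝ (fun y => y + φ t y) x = ContinuousLinearMap.id ℝ E + g t x :=
    ((hasFDerivAt_id x).add (hder t ht x)).fderiv
  rw [hfd]
  have hA : AEStronglyMeasurable (fun s => fderiv ℝ (v s) (x + φ s x)) unitVolume :=
    hv.fderiv.meas _ (continuous_const.add (hφ.cont x))
  have hAm : ∀ᵐ s ∂unitVolume, ‖fderiv ℝ (v s) (x + φ s x)‖ ≤ m s :=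
    hv.ae.mono fun s hs => hs.2.2.holderBound.bound _
  have hg0 : g 0 x = 0 := by rw [hg.eq x 0 (by simp), intervalIntegral.integral_same]
  have hinj : ∀ t ∈ Icc (0 : ℝ) 1, (ContinuousLinearMap.id ℝ E + g t x).det ≠ 0 := by
    intro t ht hdet
    obtain ⟨w, hw, hw0⟩ := (Submodule.ne_bot_iff _).1
      (LinearMap.bot_lt_ker_of_det_eq_zero hdet).ne'
    -- A kernel vector `w` at time `t` gives a solution `y` of a homogeneous linear equation with `y
    -- 0 = w` and `y t = 0`; backward Gronwall forces `w = 0`.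
    set y : ℝ → E := fun s => w + g s x w with hy
    have hyc : Continuous y := continuous_const.add ((hg.cont x).clm_apply continuous_const)
    have hyt : y t = 0 := hw
    have hi := integrable_clm_apply hm hA hAm hyc
    have hyeq : ∀ τ ∈ Icc (0 : ℝ) 1,
        y τ = w + ∫ s in (0 : ℝ)..τ, fderiv ℝ (v s) (x + φ s x) (y s) := fun τ hτ => by
      have hgi : Integrable (fun s => ContinuousLinearMap.compL ℝ E E E
          (fderiv ℝ (v s) (x + φ s x)) (g s x) + fderiv ℝ (v s) (x + φ s x)) unitVolume := by
        refine Integrable.add (integrable_clm_apply hm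
          ((ContinuousLinearMap.continuous _).comp_aestronglyMeasurable hA) ?_ (hg.cont x))
          (hm.mono' hA hAm)
        filter_upwards [hAm] with s hs
        refine ((ContinuousLinearMap.compL ℝ E E E).le_of_opNorm_le
          (ContinuousLinearMap.norm_compL_le ℝ E E E) _).trans ?_
        simpa using hs
      have i3 := intervalIntegrable_of_integrable hgi (a := 0) (by simp) hτ
      simp only [hy]
      rw [hg.eq x τ hτ, ContinuousLinearMap.intervalIntegral_apply i3]
      congr 2
      funext s
      simp [add_comm]
    have hle := backward_gronwall (g := fun s => ‖y s‖) hm hm0 hyc.norm.continuousOn ht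
      (fun τ hτ => by
        have hτ' : τ ∈ Icc (0 : ℝ) 1 := ⟨hτ.1, hτ.2.trans ht.2⟩
        have e : y τ = -∫ s in τ..t, fderiv ℝ (v s) (x + φ s x) (y s) := by
          have e1 := hyeq t ht
          rw [hyt] at e1
          rw [← intervalIntegral.integral_interval_sub_left
            (intervalIntegrable_of_integrable hi (a := 0) (by simp) ht)
            (intervalIntegrable_of_integrable hi (a := 0) (by simp) hτ'), hyeq τ hτ', neg_sub]
          rw [eq_comm, add_comm] at e1
          rw [eq_neg_of_add_eq_zero_left e1]
          abel
        rw [e, norm_neg]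
        refine norm_intervalIntegral_le
          (integrable_mul_of_continuousOn hm hyc.norm.continuousOn) ?_ hτ' ht hτ.2
        filter_upwards [hAm] with s hs
        exact ContinuousLinearMap.le_of_opNorm_le _ hs _) 0 ⟨le_rfl, ht.1⟩
    have : y 0 = 0 := norm_le_zero_iff.1 hle
    simp [hy, hg0] at this
    exact hw0 this
  have hcont : Continuous fun s => (ContinuousLinearMap.id ℝ E + g s x).det :=
    ContinuousLinearMap.continuous_det.comp (continuous_const.add (hg.cont x))
  have hdet0 : (ContinuousLinearMap.id ℝ E + g 0 x).det = 1 := by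
    rw [hg0, add_zero]
    exact LinearMap.det_id
  by_contra! hneg
  obtain ⟨s, hs, hs0⟩ := intermediate_value_Icc' ht.1 hcont.continuousOn
    (show (0 : ℝ) ∈ Icc _ _ from ⟨hneg, by rw [hdet0]; exact zero_le_one⟩)
  exact hinj s ⟨hs.1, hs.2.trans ht.2⟩ hs0

/-- Joint continuity of evaluation is what makes a Bochner measurable field measurable along
continuous curves. -/
theorem HolderZero.continuous_eval {n : ℕ} {β : ℝ≥0} :
    Continuous fun p : HolderZero E E n β × E => p.1 p.2 := by
  refine continuous_iff_continuousAt.2 fun ⟨f₀, x₀⟩ => ?_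
  have h1 : Continuous (f₀ : E → E) := f₀.2.1.continuous
  have hle : ∀ (f : HolderZero E E n β) x, ‖f x‖ ≤ ‖f‖ := fun f x => by
    rw [HolderZero.norm_def, ← toReal_enorm]
    exact ENNReal.toReal_mono f.2.2.1.ne (enorm_apply_le_eCkHolderNorm n β _ x)
  rw [ContinuousAt, tendsto_iff_norm_sub_tendsto_zero]
  refine squeeze_zero (g := fun p : HolderZero E E n β × E => ‖p.1 - f₀‖ + ‖f₀ p.2 - f₀ x₀‖)
    (fun _ => norm_nonneg _) (fun p => ?_) ?_
  · have h2 := norm_sub_le_norm_sub_add_norm_sub (p.1 p.2) (f₀ p.2) (f₀ x₀)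
    have h3 := hle (p.1 - f₀) p.2
    have h4 : (p.1 - f₀ : HolderZero E E n β) p.2 = p.1 p.2 - f₀ p.2 := rfl
    rw [h4] at h3
    linarith
  · have h2 : Continuous fun p : HolderZero E E n β × E => ‖p.1 - f₀‖ + ‖f₀ p.2 - f₀ x₀‖ := by
      fun_prop
    simpa using h2.tendsto (f₀, x₀)

theorem HolderZero.fieldCkBound {n : ℕ} {β : ℝ≥0} (hβ : β ≤ 1) {u : ℝ → HolderZero E E n β}
    (hu : AEStronglyMeasurable u unitVolume) :
    FieldCkBound n β (fun s => 2 * ‖u s‖) (fun s => (u s : E → E)) where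
  meas _ hc := HolderZero.continuous_eval.comp_aestronglyMeasurable
    (hu.prodMk hc.aestronglyMeasurable)
  ae := ae_of_all _ fun s => HolderZero.ckBound hβ (u s)

theorem isPointwiseFlow_of_isFlowDisp {d n : ℕ} {β : ℝ≥0} (hβ : β ≤ 1) {u : TimeDepField d n β}
    {φ : ℝ → EuclideanSpace ℝ (Fin d) → EuclideanSpace ℝ (Fin d)}
    (hφ : IsFlowDisp (fun s => (u s : EuclideanSpace ℝ (Fin d) → EuclideanSpace ℝ (Fin d))) φ) :
    IsPointwiseFlow u (fun t x => x + φ t x) := by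
  intro x
  have hu := L1.integrable_coeFn u
  have hi := hφ.integrable (hu.norm.const_mul 2)
    (HolderZero.fieldCkBound hβ hu.aestronglyMeasurable) x
  refine ⟨IntegrableOn.congr_fun hi (fun s hs => ?_) measurableSet_Icc, fun t => ?_⟩
  · dsimp only
    rw [projIcc_of_mem _ hs]
  · refine (congrArg (x + ·) (hφ.eq x t t.2)).trans ?_
    congr 1
    refine intervalIntegral.integral_congr fun s hs => ?_
    rw [uIcc_of_le t.2.1] at hs
    dsimp only
    rw [projIcc_of_mem _ ⟨hs.1, hs.2.trans t.2.2⟩]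

/-- Continuity in time is not part of the definition of a pointwise flow; it follows from the
integral equation. Outside the unit interval the displacement is frozen by `projIcc`. -/
theorem IsPointwiseFlow.isFlowDisp {d n : ℕ} {β : ℝ≥0} {u : TimeDepField d n β}
    {Ψ : Icc (0 : ℝ) 1 → EuclideanSpace ℝ (Fin d) → EuclideanSpace ℝ (Fin d)}
    (hΨ : IsPointwiseFlow u Ψ) :
    IsFlowDisp (fun s => (u s : EuclideanSpace ℝ (Fin d) → EuclideanSpace ℝ (Fin d)))
      (fun t x => Ψ (projIcc 0 1 zero_le_one t) x - x) where
  cont x := by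
    have h1 := (continuousOn_primitive_unit (hΨ x).1).domRestrict.comp
      (continuous_projIcc (h := zero_le_one (α := ℝ)))
    refine h1.congr fun t => ?_
    rw [(hΨ x).2, add_sub_cancel_left]
    rfl
  eq x t ht := by
    rw [(hΨ x).2, add_sub_cancel_left, projIcc_of_mem _ ht]
    simp only [add_sub_cancel]

theorem exists_flow (d n : ℕ) (hn : 1 ≤ n) (α β : ℝ≥0) (hα : 0 < α) (hαβ : α < β) (hβ : β ≤ 1)
    (u : TimeDepField d n β) :
    ∃ Φ : C(Icc (0 : ℝ) 1, HolderDiffeo d n α),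
      IsFlowDisp (fun s => (u s : EuclideanSpace ℝ (Fin d) → EuclideanSpace ℝ (Fin d)))
        (fun t => (Φ (projIcc 0 1 zero_le_one t)).disp) := by
  obtain ⟨k, rfl⟩ := Nat.exists_eq_add_of_le' hn
  have hu := L1.integrable_coeFn u
  have hm : Integrable (fun s => 2 * ‖u s‖) unitVolume := hu.norm.const_mul 2
  have hm0 : ∀ s, 0 ≤ 2 * ‖u s‖ := fun s => by positivity
  have hv := HolderZero.fieldCkBound hβ hu.aestronglyMeasurable
  have h0 : (0 : ℝ) ≤ β := β.coe_nonneg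
  have h1 : (β : ℝ) ≤ 1 := by exact_mod_cast hβ
  have hαβ' : (α : ℝ) ≤ β := by exact_mod_cast hαβ.le
  obtain ⟨φ, hφ⟩ := exists_isFlowDisp hm hm0 hv
  obtain ⟨C, hC, hck⟩ := IsFlowDisp.ckBound (E := EuclideanSpace ℝ (Fin d)) h0 h1
    (integral_nonneg hm0) (k + 1) (n := k) le_rfl
  obtain ⟨C', hC', hct⟩ := hφ.ckBound_sub_time h0 h1 hm hm0 hv
  have hα0 := α.coe_nonneg
  let Φ : Icc (0 : ℝ) 1 → HolderDiffeo d (k + 1) α := fun t =>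
    ⟨((hck hφ hm hm0 le_rfl hv t t.2).mono_exponent hα0 hαβ').toHolderZero hα,
      hφ.det_pos h0 h1 hm hm0 hv t.2⟩
  -- The modulus of continuity in time is that of the primitive of `2 * ‖u s‖`; the factor `2`
  -- before `C'` comes from lowering the exponent `β` to `α`.
  have hdist : ∀ t₁ t₂ : Icc (0 : ℝ) 1, t₁ ≤ t₂ → dist (Φ t₂) (Φ t₁) ≤
      2 * C' * |(∫ s in (0 : ℝ)..t₂, 2 * ‖u s‖) - ∫ s in (0 : ℝ)..t₁, 2 * ‖u s‖| := by
    intro t₁ t₂ h12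
    have e : dist (Φ t₂) (Φ t₁) = ‖(Φ t₂).disp - (Φ t₁).disp‖ :=
      dist_eq_norm (Φ t₂).disp (Φ t₁).disp
    rw [e, intervalIntegral.integral_interval_sub_left
        (intervalIntegrable_of_integrable hm (by simp) t₂.2)
        (intervalIntegrable_of_integrable hm (by simp) t₁.2), abs_of_nonneg
        (intervalIntegral.integral_nonneg h12 fun s _ => hm0 s), mul_assoc]
    exact HolderZero.norm_le ((hct t₁ t₁.2 t₂ t₂.2 h12).mono_exponent hα0 hαβ')
  have hdist' : ∀ t₁ t₂ : Icc (0 : ℝ) 1, dist (Φ t₂) (Φ t₁) ≤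
      2 * C' * |(∫ s in (0 : ℝ)..t₂, 2 * ‖u s‖) - ∫ s in (0 : ℝ)..t₁, 2 * ‖u s‖| := by
    intro t₁ t₂
    rcases le_total t₁ t₂ with h | h
    · exact hdist t₁ t₂ h
    · rw [dist_comm, abs_sub_comm]
      exact hdist t₂ t₁ h
  have hMc : Continuous fun t : Icc (0 : ℝ) 1 => ∫ s in (0 : ℝ)..t, 2 * ‖u s‖ :=
    (continuousOn_primitive_unit hm).domRestrict
  have hΦ : Continuous Φ := by
    refine continuous_iff_continuousAt.2 fun t => ?_
    rw [ContinuousAt, tendsto_iff_dist_tendsto_zero]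
    refine squeeze_zero (fun _ => dist_nonneg) (fun t' => hdist' t t') ?_
    have : Continuous fun t' : Icc (0 : ℝ) 1 => 2 * C' *
        |(∫ s in (0 : ℝ)..t', 2 * ‖u s‖) - ∫ s in (0 : ℝ)..t, 2 * ‖u s‖| := by fun_prop
    simpa using this.tendsto t
  refine ⟨⟨Φ, hΦ⟩, fun x => ?_, fun x t ht => ?_⟩
  · exact (hφ.cont x).comp (continuous_subtype_val.comp continuous_projIcc)
  · rw [projIcc_of_mem _ ht]
    refine (hφ.eq x t ht).trans (intervalIntegral.integral_congr fun s hs => ?_)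
    rw [uIcc_of_le ht.1] at hs
    rw [projIcc_of_mem _ ⟨hs.1, hs.2.trans ht.2⟩]
    rfl

/-- The constant depends on the fields only through the bound `R` on their masses. Two flows have a
bounded distance in `C^{n,β}` and one of order `D ^ β` in `C^n`; the rest is interpolation. -/
theorem exists_holder_bound (d n : ℕ) (hn : 1 ≤ n) (α β : ℝ≥0) (hα : 0 < α) (hαβ : α < β)
    (hβ : β ≤ 1) {R : ℝ} (hR : 0 ≤ R) :
    ∃ C : ℝ, 0 ≤ C ∧ ∀ (u v : TimeDepField d n β)
      (Φ Ψ : C(Icc (0 : ℝ) 1, HolderDiffeo d n α)),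
      IsFlowDisp (fun s => (u s : EuclideanSpace ℝ (Fin d) → EuclideanSpace ℝ (Fin d)))
        (fun t => (Φ (projIcc 0 1 zero_le_one t)).disp) →
      IsFlowDisp (fun s => (v s : EuclideanSpace ℝ (Fin d) → EuclideanSpace ℝ (Fin d)))
        (fun t => (Ψ (projIcc 0 1 zero_le_one t)).disp) →
      2 * ‖u‖ ≤ R → 2 * ‖v‖ ≤ R → 2 * ‖u - v‖ ≤ 1 →
      dist Φ Ψ ≤ C * (2 * ‖u - v‖) ^ (β - α : ℝ) := by
  obtain ⟨k, rfl⟩ := Nat.exists_eq_add_of_le' hn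
  have h0 : (0 : ℝ) ≤ β := β.coe_nonneg
  have h1 : (β : ℝ) ≤ 1 := by exact_mod_cast hβ
  have hαβ' : (α : ℝ) < β := by exact_mod_cast hαβ
  have hα' : (0 : ℝ) < α := by exact_mod_cast hα
  obtain ⟨C₁, hC₁, hck⟩ := IsFlowDisp.ckBound (E := EuclideanSpace ℝ (Fin d)) h0 h1 hR
    (k + 1) (n := k) le_rfl
  obtain ⟨C₂, hC₂, hsub⟩ := IsFlowDisp.ckBound_sub (E := EuclideanSpace ℝ (Fin d)) h0 h1 hR
    (k + 1) (n := k) le_rfl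
  refine ⟨C₁ + C₁ + C₂, by positivity, fun u v Φ Ψ hΦ hΨ huR hvR huv => ?_⟩
  have hmass : ∀ w : TimeDepField d (k + 1) β, ∫ s, 2 * ‖w s‖ ∂unitVolume = 2 * ‖w‖ := fun w => by
    rw [integral_const_mul, L1.norm_eq_integral_norm]
  have hu := L1.integrable_coeFn u
  have hv := L1.integrable_coeFn v
  have hD : ∫ s, 2 * ‖u s - v s‖ ∂unitVolume = 2 * ‖u - v‖ := by
    rw [← hmass]
    refine integral_congr_ae ?_
    filter_upwards [Lp.coeFn_sub u v] with s hs
    rw [hs, Pi.sub_apply]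
  have hfu := HolderZero.fieldCkBound hβ hu.aestronglyMeasurable
  have hfv := HolderZero.fieldCkBound hβ hv.aestronglyMeasurable
  have hfd := HolderZero.fieldCkBound hβ (hu.sub hv).aestronglyMeasurable
  set D := 2 * ‖u - v‖
  have hD0 : 0 ≤ D := by positivity
  refine (ContinuousMap.dist_le (by positivity)).2 fun t => ?_
  have hA := (hck hΦ (hu.norm.const_mul 2) (fun s => by positivity) ((hmass u).trans_le huR) hfu
    t t.2).sub (hck hΨ (hv.norm.const_mul 2) (fun s => by positivity) ((hmass v).trans_le hvR) hfv
    t t.2)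
  have hB := hsub hΦ hΨ (hu.norm.const_mul 2) (fun s => by positivity) ((hmass u).trans_le huR) hfu
    (hv.norm.const_mul 2) (fun s => by positivity) ((hmass v).trans_le hvR) hfv
    ((hu.sub hv).norm.const_mul 2) (fun s => by positivity) (hD.trans_le huv) hfd t t.2
  simp only [projIcc_val] at hA hB
  have hint : CkBound (k + 1) α ((C₁ + C₁ + C₂) * D ^ (β - α : ℝ))
      (fun x => (Φ t).disp x - (Ψ t).disp x) := by
    have hDβ : D ^ (β : ℝ) ≤ D ^ (β - α : ℝ) :=
      Real.rpow_le_rpow_of_exponent_ge' hD0 huv (by linarith) (by linarith)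
    -- Both bounds are enlarged to the common factor `C₁ + C₁ + C₂`, whose powers `α / β` and `1 - α
    -- / β` multiply back to itself, while `D ^ (β * (1 - α / β))` is `D ^ (β - α)`.
    refine (hA.mono (le_add_of_nonneg_right hC₂)).interpolate (B := (C₁ + C₁ + C₂) * D ^ (β : ℝ))
      hα' hαβ' (hB.mono ?_) (by gcongr) (le_of_eq ?_)
    · have e : (∫ s, 2 * ‖(u s - v s)‖ ∂unitVolume) = D := hD
      calc _ = C₂ * D ^ (β : ℝ) := by rw [← e]; rfl
        _ ≤ _ := by gcongr; linarith
    · rw [Real.mul_rpow (by positivity) (by positivity), ← Real.rpow_mul hD0, ← mul_assoc,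
        ← Real.rpow_add_of_nonneg (by positivity) (by positivity)
          (by rw [sub_nonneg, div_le_one (by linarith)]; exact hαβ'.le),
        add_sub_cancel, Real.rpow_one, mul_sub, mul_one, mul_div_cancel₀ _ (by linarith)]
  have e : dist (Φ t) (Ψ t) = ‖(Φ t).disp - (Ψ t).disp‖ :=
    dist_eq_norm (Φ t).disp (Ψ t).disp
  rw [e]
  exact HolderZero.norm_le hint

end FlowMap

end HolderFlow

/-! ### Assembly of the theorem. -/

theorem mainTheorem5 (d n : ℕ) (hn : 2 ≤ n) (α β : ℝ≥0) (hα : 0 < α) (hαβ : α < β) (hβ : β ≤ 1) :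
    ∃ flow : TimeDepField d n β → C(Icc (0 : ℝ) 1, HolderDiffeo d n α),
      (∀ u : TimeDepField d n β,
        IsPointwiseFlow u (fun t x => (flow u t).toFun x) ∧
        ∀ Ψ : Icc (0 : ℝ) 1 → EuclideanSpace ℝ (Fin d) → EuclideanSpace ℝ (Fin d),
          IsPointwiseFlow u Ψ → Ψ = fun t x => (flow u t).toFun x) ∧
      Continuous flow ∧
      ∀ u₀ : TimeDepField d n β, ∃ V ∈ 𝓝 u₀, ∃ C : ℝ≥0, HolderOnWith C (β - α) flow V := by
  have hn1 : 1 ≤ n := by omega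
  choose flow hflow using exists_flow d n hn1 α β hα hαβ hβ
  have hholder : ∀ u₀ : TimeDepField d n β, ∃ V ∈ 𝓝 u₀, ∃ C : ℝ≥0,
      HolderOnWith C (β - α) flow V := by
    intro u₀
    obtain ⟨C, hC, hle⟩ := exists_holder_bound d n hn1 α β hα hαβ hβ
      (show 0 ≤ 2 * (‖u₀‖ + 1) by positivity)
    -- Radius `1 / 4` keeps two points of the ball within `1 / 2`, so the mass `2 * ‖u - v‖` is at
    -- most `1`.
    refine ⟨Metric.ball u₀ (1 / 4), Metric.ball_mem_nhds _ (by norm_num),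
      (C * 2 ^ (β - α : ℝ)).toNNReal, fun u hu v hv => ?_⟩
    have hbd : ∀ w ∈ Metric.ball u₀ (1 / 4), 2 * ‖w‖ ≤ 2 * (‖u₀‖ + 1) := fun w hw => by
      rw [mem_ball_iff_norm] at hw
      have := norm_le_norm_add_norm_sub' w u₀
      linarith
    have huv : 2 * ‖u - v‖ ≤ 1 := by
      rw [mem_ball_iff_norm] at hu hv
      have := norm_sub_le_norm_sub_add_norm_sub u u₀ v
      rw [norm_sub_rev u₀ v] at this
      linarith
    have h := hle u v (flow u) (flow v) (hflow u) (hflow v) (hbd u hu) (hbd v hv) huv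
    rw [Real.mul_rpow zero_le_two (norm_nonneg _), ← mul_assoc, ← dist_eq_norm] at h
    have hr : ((β - α : ℝ≥0) : ℝ) = β - α := NNReal.coe_sub hαβ.le
    rw [edist_dist, edist_dist, hr, ENNReal.ofReal_rpow_of_nonneg dist_nonneg
      (sub_nonneg.2 (by exact_mod_cast hαβ.le)), ← ENNReal.ofReal.eq_1,
      ← ENNReal.ofReal_mul (by positivity)]
    exact ENNReal.ofReal_le_ofReal h
  refine ⟨flow, fun u => ⟨?_, fun Ψ hΨ => ?_⟩, ?_, hholder⟩
  · have h := isPointwiseFlow_of_isFlowDisp hβ (hflow u)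
    simp only [projIcc_val] at h
    exact h
  · obtain ⟨k, rfl⟩ := Nat.exists_eq_add_of_le' hn1
    have hu := L1.integrable_coeFn u
    have hfu := HolderZero.fieldCkBound hβ hu.aestronglyMeasurable
    funext t x
    -- Uniqueness is the comparison of two flows with equal fields and equal starting points: the
    -- right side of the estimate vanishes.
    have h := hΨ.isFlowDisp.norm_sub_le_of_field (hflow u) (hu.norm.const_mul 2)
      (fun s => by positivity) le_rfl hfu (hu.norm.const_mul 2) (hfu.of_le k.le_succ)
      (q := fun _ => 0) (integrable_zero _ _ _) (fun _ => le_rfl) (by simp) t.2 x x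
    simp only [sub_self, norm_zero, mul_zero, integral_zero, add_zero, projIcc_val] at h
    have h' := sub_eq_zero.1 (norm_le_zero_iff.1 h)
    rw [HolderDiffeo.toFun, ← h', add_sub_cancel]
  · refine continuous_iff_continuousAt.2 fun u₀ => ?_
    obtain ⟨V, hV, C, hC⟩ := hholder u₀
    exact (hC.continuousOn (tsub_pos_of_lt hαβ)).continuousAt hV
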